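/- **Class and symmetries.** Consider the equations $$u_t=f(t)\,u_{yy}-u\,u_x, \tag{E}$$ where $f$ is a smooth, nowhere vanishing real function on a nonempty open interval $I\subseteq\mathbb R$. A Lie symmetry of (E) is a smooth vector field $Q=\tau\partial_t+\xi\partial_x+\eta\partial_y+\theta\partial_u$ on $I\times\mathbb R^3\ni(t,x,y,u)$ whose second prolongation satisfies $Q^{(2)}\{u_t-f u_{yy}+uu_x\}=0$ at every second-order jet that satisfies (E). The Lie symmetries form the maximal Lie invariance algebra $A^{\max}=A^{\max}(f,I)$. **Equivalence.** Let $G_1^\sim$ be the set of the transformations $$\tilde t=\frac{\alpha t+\beta}{\gamma t+\delta},\quad \tilde x=\frac{\kappa x+\mu t+\nu}{\gamma t+\delta},\quad \tilde y=\lambda y+\varepsilon,\quad \tilde u=\frac1\Delta\bigl(\kappa(\gamma t+\delta)u-\kappa\gamma x+\delta\mu-\gamma\nu\bigr),\quad \tilde f(\tilde t)=\frac{\lambda^2}{\Delta}(\gamma t+\delta)^2f(t),$$ with real constants such that $\Delta=\alpha\delta-\beta\gamma\ne0$, $\kappa\neq 0$, $\lambda\ne0$. Such a transformation applies to $(f,I)$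 if $\gamma t+\delta\neq0$ on $I$; it then maps $I\times\mathbb R^3$ onto $\tilde I\times\mathbb R^3$, where $\tilde I$ is the image of $I$ under $t\mapsto\tilde t$, and $(f,I)$ is called equivalent to $(\tilde f,\tilde I)$. **Theorem.** (0) If a transformation of $G_1^\sim$ maps $(f,I)$ to $(\tilde f,\tilde I)$, then $\tilde f$ is smooth and nowhere zero on the open interval $\tilde I$, and a function on $I\times\mathbb R^2$ is a classical ($C^2$) solution of (E) if and only if the function on $\tilde I\times\mathbb R^2$ whose graph is the image of its graph is a classical solution of (E) with $\tilde f$. For every $(f,I)$ the space $A^{\max}$ is closed under the Lie bracket. (1) For every nonempty open interval $I$, the vector fields that belong to $A^{\max}(f,I)$ for all smooth nowhere vanishing $f$ on $I$ form the four-dimensional algebra with basis $$\partial_x,\quad \partial_y,\quad x\partial_x+u\partial_u,\quad t\partial_x+\partial_u, \tag{B}$$ and there is an $f$ for which (B) is a basis of $A^{\max}(f,I)$. On every nonempty open interval $I$ (not containing $0$ in (3)) a basis of $A^{\max}$ consists of the four fields (B) together with: (2) for $f=\dfrac{e^{\sigma\arctan t}}{t^2+1}$, $\sigma\in\mathbb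 R$: $\ (t^2+1)\partial_t+tx\partial_x+\frac12\sigma y\partial_y+(x-tu)\partial_u$; (3) for $f=|t|^\rho$, $\rho\in\mathbb R\setminus\{0,-2\}$: $\ 2t\partial_t+(\rho+1)y\partial_y-2u\partial_u$; (4) for $f=e^t$ and for $f=-e^t$: $\ 2\partial_t+y\partial_y$; (5) for $f=1$: $\ \partial_t,\ \ 2t\partial_t+y\partial_y-2u\partial_u$. So the dimension of $A^{\max}$ is $5$ in (2)–(4) and $6$ in (5). Moreover, for every real $\rho$ and every nonempty open interval $I\not\ni0$, the pair $(|t|^\rho,I)$ is equivalent to $(|t|^{-2-\rho},\{-1/t: t\in I\})$, so that $\rho\le-1$ can be assumed in (3). The list is complete and irredundant: for every smooth nowhere vanishing $f$ on a nonempty open interval $I$, exactly one of the following holds: * (B) is a basis of $A^{\max}(f,I)$, and $(f,I)$ is not equivalent to any of the coefficients (2), (3) with $\rho\le-1$, (4), (5) on any interval; * (B) is not a basis of $A^{\max}(f,I)$, and there is exactly one of the coefficients $\frac{e^{\sigma\arctan t}}{t^2+1}$ ($\sigma\in\mathbb R$), $|t|^\rho$ ($\rho\le-1$, $\rho\ne-2$),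 $e^t$, $-e^t$, $1$ to which, on some interval (not containing $0$ for $|t|^\rho$), $(f,I)$ is equivalent. -/

import Mathlib

open scoped ContDiff

namespace Kolmogorov

/-- The space of variables: `z.1 0 = t`, `z.1 1 = x`, `z.1 2 = y`, `z.2 = u`. -/
abbrev Pt := (Fin 3 → ℝ) × ℝ

/-- The second jet space: a point `(t, x, y, u)`, the first derivatives `p i` and the second
derivatives `r i j` of `u`, all indexed by `t = 0`, `x = 1`, `y = 2`. -/
abbrev Jet := Pt × (Fin 3 → ℝ) × (Fin 3 → Fin 3 → ℝ)

/-- A vector field `τ ∂_t + ξ ∂_x + η ∂_y + θ ∂_u`: the first component of the value is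
`(τ, ξ, η)`, the second one is `θ`. -/
abbrev VField := Pt → Pt

/-- The domain `I × ℝ³`: `t` lies in `I`, and `x`, `y`, `u` are arbitrary. -/
def dom (I : Set ℝ) : Set Pt := {z | z.1 0 ∈ I}

/-- `f` is an admissible coefficient on `I`: `I` is a nonempty open interval and `f` is smooth
and nowhere zero on it. -/
structure InClass (f : ℝ → ℝ) (I : Set ℝ) : Prop where
  isOpen : IsOpen I
  ordConnected : I.OrdConnected
  nonempty : I.Nonempty
  smooth : ContDiffOn ℝ ∞ f I
  ne_zero : ∀ t ∈ I, f t ≠ 0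

/-- The left-hand side of the equation `u_t - f(t) u_yy + u u_x = 0`, as a function of jets. -/
def equation (f : ℝ → ℝ) (j : Jet) : ℝ :=
  j.2.1 0 - f (j.1.1 0) * j.2.2 2 2 + j.1.2 * j.2.1 1

/-- The second jet of a function `w(t, x, y)`. -/
noncomputable def jetOf (w : (Fin 3 → ℝ) → ℝ) (s : Fin 3 → ℝ) : Jet :=
  ((s, w s), fun i => fderiv ℝ w s (Pi.single i 1),
    fun i j => fderiv ℝ (fun s' => fderiv ℝ w s' (Pi.single i 1)) s (Pi.single j 1))

/-- Classical solutions of `u_t = f(t) u_yy - u u_x` on `I × ℝ²`. -/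
def IsSolution (f : ℝ → ℝ) (I : Set ℝ) (w : (Fin 3 → ℝ) → ℝ) : Prop :=
  ContDiffOn ℝ 2 w {s | s 0 ∈ I} ∧ ∀ s : Fin 3 → ℝ, s 0 ∈ I → equation f (jetOf w s) = 0

/-! ### Prolongation and Lie symmetries -/

/-- Total derivative `D_i F = F_i + u_i F_u` of a function of `(t, x, y, u)`. -/
noncomputable def totalDeriv (i : Fin 3) (F : Pt → ℝ) (z : Pt) (p : Fin 3 → ℝ) : ℝ :=
  fderiv ℝ F z (Pi.single i 1, p i)

/-- Total derivative `D_j G = G_j + u_j G_u + ∑ k, u_{kj} G_{u_k}` of a function of first jets. -/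
noncomputable def totalDerivJet (j : Fin 3) (G : Pt × (Fin 3 → ℝ) → ℝ)
    (z : Pt) (p : Fin 3 → ℝ) (r : Fin 3 → Fin 3 → ℝ) : ℝ :=
  fderiv ℝ G (z, p) ((Pi.single j 1, p j), fun k => r k j)

/-- First prolongation coefficients
`θ^i = D_i θ - u_t D_i τ - u_x D_i ξ - u_y D_i η`. -/
noncomputable def prolong₁ (V : VField) (i : Fin 3) (z : Pt) (p : Fin 3 → ℝ) : ℝ :=
  totalDeriv i (fun z' => (V z').2) z p
    - ∑ k, p k * totalDeriv i (fun z' => (V z').1 k) z p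

/-- Second prolongation coefficients
`θ^{ij} = D_j θ^i - u_{it} D_j τ - u_{ix} D_j ξ - u_{iy} D_j η`. -/
noncomputable def prolong₂ (V : VField) (i j : Fin 3)
    (z : Pt) (p : Fin 3 → ℝ) (r : Fin 3 → Fin 3 → ℝ) : ℝ :=
  totalDerivJet j (fun q => prolong₁ V i q.1 q.2) z p r
    - ∑ k, r i k * totalDeriv j (fun z' => (V z').1 k) z p

/-- The second prolongation of `V`, as a vector field on the second jet space. -/
noncomputable def prolongation (V : VField) (j : Jet) : Jet :=
  (V j.1, fun i => prolong₁ V i j.1 j.2.1, fun i k => prolong₂ V i k j.1 j.2.1 j.2.2)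

/-- `V` is a smooth vector field on `I × ℝ³` that satisfies the infinitesimal invariance
criterion: its second prolongation, applied to `u_t - f u_yy + u u_x`, vanishes at every jet
(over `I`) that satisfies the equation. -/
def IsLieSymmetry (f : ℝ → ℝ) (I : Set ℝ) (V : VField) : Prop :=
  ContDiffOn ℝ ∞ V (dom I) ∧
    ∀ j : Jet, j.1 ∈ dom I → (∀ i k, j.2.2 i k = j.2.2 k i) → equation f j = 0 →
      fderiv ℝ (equation f) j (prolongation V j) = 0

/-- The maximal Lie invariance algebra, as a set of vector fields on `I × ℝ³`. -/
def maxAlgebra (f : ℝ → ℝ) (I : Set ℝ) : Set (dom I → Pt) :=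
  {Q | ∃ V : VField, IsLieSymmetry f I V ∧ Q = (dom I).domRestrict V}

/-- The fields `B i`, restricted to `I × ℝ³`, form a basis of the maximal Lie invariance
algebra. -/
def IsBasisOfMaxAlgebra (f : ℝ → ℝ) (I : Set ℝ) {n : ℕ} (B : Fin n → VField) : Prop :=
  LinearIndependent ℝ (fun i => (dom I).domRestrict (B i)) ∧
    maxAlgebra f I = (Submodule.span ℝ (Set.range fun i => (dom I).domRestrict (B i)) : Set _)

/-! ### The vector fields of the classification -/

/-- `∂_x` -/
def dX : VField := fun _ => (![0, 1, 0], 0)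

/-- `∂_y` -/
def dY : VField := fun _ => (![0, 0, 1], 0)

/-- `x ∂_x + u ∂_u` -/
def scaling : VField := fun z => (![0, z.1 1, 0], z.2)

/-- `t ∂_x + ∂_u` -/
def galilean : VField := fun z => (![0, z.1 0, 0], 1)

/-- `(t² + 1) ∂_t + t x ∂_x + (σ/2) y ∂_y + (x - t u) ∂_u` -/
noncomputable def extArctan (σ : ℝ) : VField := fun z =>
  (![z.1 0 ^ 2 + 1, z.1 0 * z.1 1, 1 / 2 * σ * z.1 2], z.1 1 - z.1 0 * z.2)

/-- `2 t ∂_t + (ρ + 1) y ∂_y - 2 u ∂_u` -/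
def extPower (ρ : ℝ) : VField := fun z => (![2 * z.1 0, 0, (ρ + 1) * z.1 2], -2 * z.2)

/-- `2 ∂_t + y ∂_y` -/
def extExp : VField := fun z => (![2, 0, z.1 2], 0)

/-- `∂_t` -/
def dT : VField := fun _ => (![1, 0, 0], 0)

/-- `2 t ∂_t + y ∂_y - 2 u ∂_u` -/
def extConst : VField := fun z => (![2 * z.1 0, 0, z.1 2], -2 * z.2)

/-- The basis for arbitrary `f`. -/
def kernelBasis : Fin 4 → VField := ![dX, dY, scaling, galilean]

/-! ### The equivalence group -/

/-- The parameters of a transformation of the equivalence group. -/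
structure EquivTransf where
  (α β γ δ κ μ ν lam ε : ℝ)
  det_ne : α * δ - β * γ ≠ 0
  κ_ne : κ ≠ 0
  lam_ne : lam ≠ 0

/-- The determinant `Δ = α δ - β γ`. -/
def EquivTransf.det (g : EquivTransf) : ℝ := g.α * g.δ - g.β * g.γ

/-- The transformation `(t, x, y, u) ↦ (t̃, x̃, ỹ, ũ)` of the variables. -/
noncomputable def EquivTransf.pointMap (g : EquivTransf) (z : Pt) : Pt :=
  (![(g.α * z.1 0 + g.β) / (g.γ * z.1 0 + g.δ),
      (g.κ * z.1 1 + g.μ * z.1 0 + g.ν) / (g.γ * z.1 0 + g.δ),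
      g.lam * z.1 2 + g.ε],
    1 / g.det * (g.κ * (g.γ * z.1 0 + g.δ) * z.2 - g.κ * g.γ * z.1 1 + g.δ * g.μ - g.γ * g.ν))

/-- The transformation `g` is defined over `I`, maps `I × ℝ³` onto `I' × ℝ³`, and maps the
coefficient `f` on `I` to the coefficient `f'` on `I'`:
`f'(t̃) = (λ² / Δ) (γ t + δ)² f(t)`. -/
def EquivTransf.Carries (g : EquivTransf) (f : ℝ → ℝ) (I : Set ℝ) (f' : ℝ → ℝ) (I' : Set ℝ) :
    Prop :=
  (∀ t ∈ I, g.γ * t + g.δ ≠ 0) ∧ g.pointMap '' dom I = dom I' ∧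
    ∀ z ∈ dom I, f' ((g.pointMap z).1 0) =
      g.lam ^ 2 / g.det * (g.γ * z.1 0 + g.δ) ^ 2 * f (z.1 0)

/-- Equivalence of two equations of the class under the equivalence group. -/
def Equivalent (f : ℝ → ℝ) (I : Set ℝ) (f' : ℝ → ℝ) (I' : Set ℝ) : Prop :=
  ∃ g : EquivTransf, g.Carries f I f' I'

/-! ### The canonical forms -/

/-- The classification cases with extension of the Lie symmetry algebra. -/
inductive ExtCase where
  | arctan (σ : ℝ)
  | power (ρ : ℝ)
  | exp (s : ℝ)
  | const

/-- The canonical coefficient `f` of each case. -/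
noncomputable def ExtCase.coeff : ExtCase → ℝ → ℝ
  | .arctan σ => fun t => Real.exp (σ * Real.arctan t) / (t ^ 2 + 1)
  | .power ρ => fun t => |t| ^ ρ
  | .exp s => fun t => s * Real.exp t
  | .const => fun _ => 1

/-- The range of the parameters and of the interval `I` in each case. -/
def ExtCase.Canonical : ExtCase → Set ℝ → Prop
  | .arctan _, _ => True
  | .power ρ, I => ρ ≤ -1 ∧ ρ ≠ -2 ∧ (0 : ℝ) ∉ I
  | .exp s, _ => s = 1 ∨ s = -1
  | .const, _ => True

end Kolmogorov

/-! The jet coordinates that the equation leaves free can be varied independently. Splitting the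
invariance criterion with respect to them forces every symmetry to be polynomial: τ is quadratic in
t, η is affine in y with constant coefficients, and ξ, θ follow from τ up to kernel fields. Only one
condition still contains f, namely (τ f)' = 2 c f with c = η_y (`isLieSymmetry_iff`). The algebra of
a given f is thus the kernel plus the space of pairs (τ, c) solving this condition. For a concrete f
that space is found by comparing coefficients of a polynomial in t that vanishes on an interval.

The equivalence group acts on t by Möbius maps. Under it τ ∂_t transforms as a vector field on the
projective line, τ f is only multiplied by λ², and both c and the discriminant of τ are unchanged
(`MobiusCarries.classifying`, `MobiusCarries.exists_classifying`). For completeness, τ is brought to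
t² + 1, t or 1, the first-order equation for f is solved, and the constant factor is absorbed by
scalings and a reflection (`hasCanonical_of_classifying`). The delicate point is a root of τ inside
I, where the equation for f is singular: smoothness of f then either makes f constant or leads to a
contradiction. For irredundancy, the pair (discriminant of τ, c), up to rescaling (τ, c), separates
the canonical forms once signs are settled by the sign of f and by ρ ≤ -1 (`canonical_unique`).

That solutions go to solutions is a chain-rule computation: the transformed left-hand side is a
nonvanishing multiple of the original one (`EquivTransf.Carries.equation_jetOf`). -/

namespace Kolmogorov

/-! ### Directional derivatives on `I × ℝ³` -/

/-- The derivative of a function of `(t, x, y, u)` in the direction `v`. -/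
noncomputable def pd (v : Pt) (F : Pt → ℝ) (z : Pt) : ℝ := fderiv ℝ F z v

/-- The coordinate directions `∂_t`, `∂_x`, `∂_y`. -/
def eS (i : Fin 3) : Pt := (Pi.single i 1, 0)

/-- The coordinate direction `∂_u`. -/
def eU : Pt := (0, 1)

variable {I : Set ℝ} {F G : Pt → ℝ} {z v w : Pt}

theorem isOpen_dom (hI : IsOpen I) : IsOpen (dom I) :=
  hI.preimage ((continuous_apply 0).comp continuous_fst)

theorem convex_dom (hI : I.OrdConnected) : Convex ℝ (dom I) := by
  have h := hI.convex (𝕜 := ℝ)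
  have := h.linear_preimage ((LinearMap.proj (0 : Fin 3)).comp (LinearMap.fst ℝ (Fin 3 → ℝ) ℝ))
  exact this

theorem pd_smooth (hI : IsOpen I) (v : Pt) (hF : ContDiffOn ℝ ∞ F (dom I)) :
    ContDiffOn ℝ ∞ (pd v F) (dom I) :=
  (hF.fderiv_of_isOpen (isOpen_dom hI) (by simp)).clm_apply contDiffOn_const

theorem smooth_contDiffAt (hI : IsOpen I) (hF : ContDiffOn ℝ ∞ F (dom I)) (hz : z ∈ dom I) :
    ContDiffAt ℝ ∞ F z := hF.contDiffAt ((isOpen_dom hI).mem_nhds hz)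

theorem smooth_diffAt (hI : IsOpen I) (hF : ContDiffOn ℝ ∞ F (dom I)) (hz : z ∈ dom I) :
    DifferentiableAt ℝ F z := (smooth_contDiffAt hI hF hz).differentiableAt (by simp)

theorem pd_congr (hI : IsOpen I) (h : Set.EqOn F G (dom I)) (v : Pt) :
    Set.EqOn (pd v F) (pd v G) (dom I) := fun z hz => by
  have : F =ᶠ[nhds z] G := h.eventuallyEq_of_mem ((isOpen_dom hI).mem_nhds hz)
  simp only [pd, this.fderiv_eq]

theorem pd_comm (hI : IsOpen I) (hF : ContDiffOn ℝ ∞ F (dom I)) (hz : z ∈ dom I) (v w : Pt) :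
    pd v (pd w F) z = pd w (pd v F) z := by
  have hd : DifferentiableAt ℝ (fderiv ℝ F) z :=
    ((smooth_contDiffAt hI hF hz).fderiv_right (m := ∞) (by simp)).differentiableAt (by simp)
  have key : ∀ a b, pd a (pd b F) z = fderiv ℝ (fderiv ℝ F) z a b := by
    intro a b
    have := (hd.hasFDerivAt.clm_apply (hasFDerivAt_const b z)).fderiv
    simp [pd, this, show pd b F = fun z => fderiv ℝ F z b from rfl]
  rw [key, key]
  have := (smooth_contDiffAt hI hF hz).isSymmSndFDerivAt
    (by simpa using WithTop.coe_le_coe.2 (le_top : (2 : ℕ∞) ≤ ⊤))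
  exact this v w

theorem pd_of_const (hI : IsOpen I) {c : ℝ} (h : ∀ z ∈ dom I, F z = c) (v : Pt) :
    ∀ z ∈ dom I, pd v F z = 0 := fun z hz => by
  rw [pd_congr hI (G := fun _ => c) h v hz]
  simp [pd]

theorem pd_decomp (a : Fin 3) (b : ℝ) : pd (Pi.single a 1, b) F z
    = pd (eS a) F z + b * pd eU F z := by
  have : ((Pi.single a 1, b) : Pt) = eS a + b • eU := by simp [eS, eU]
  simp only [pd, this, map_add, map_smul, smul_eq_mul]

theorem totalDeriv_eq (i : Fin 3) (F : Pt → ℝ) (z : Pt) (p : Fin 3 → ℝ) :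
    totalDeriv i F z p = pd (eS i) F z + p i * pd eU F z := pd_decomp i (p i)

theorem add_smul_mem_dom (hz : z ∈ dom I) (hv : v.1 0 = 0) (h : ℝ) : z + h • v ∈ dom I := by
  simpa [dom, hv] using hz

theorem hasDerivAt_line (hF : DifferentiableAt ℝ F z) (v : Pt) :
    HasDerivAt (fun h : ℝ => F (z + h • v)) (pd v F z) 0 := by
  have h1 : HasDerivAt (fun h : ℝ => z + h • v) v 0 := by
    simpa using ((hasDerivAt_id (0 : ℝ)).smul_const v).const_add z
  have h2 : HasFDerivAt F (fderiv ℝ F z) (z + (0 : ℝ) • v) := by simpa using hF.hasFDerivAt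
  exact HasFDerivAt.comp_hasDerivAt (f := fun h : ℝ => z + h • v) (0 : ℝ) h2 h1

/-- A function whose derivative in a direction tangent to the fibres over `I` vanishes is constant
in this direction. -/
theorem eq_of_pd_eq_zero (hI : IsOpen I) (hF : ContDiffOn ℝ ∞ F (dom I)) (hv : v.1 0 = 0)
    (h : ∀ z ∈ dom I, pd v F z = 0) (hz : z ∈ dom I) (s : ℝ) : F (z + s • v) = F z := by
  have hd : ∀ s : ℝ, HasDerivAt (fun s : ℝ => F (z + s • v)) 0 s := by
    intro s
    have h1 := hasDerivAt_line (smooth_diffAt hI hF (add_smul_mem_dom hz hv s)) v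
    rw [h _ (add_smul_mem_dom hz hv s)] at h1
    have h2 : HasDerivAt (fun a : ℝ => a - s) 1 s := (hasDerivAt_id s).sub_const s
    have h1' : HasDerivAt (fun h : ℝ => F (z + s • v + h • v)) 0 ((fun a : ℝ => a - s) s) := by
      simpa using h1
    have := HasDerivAt.comp (h := fun a : ℝ => a - s) (h₂ := fun h : ℝ => F (z + s • v + h • v))
      s h1' h2
    simp only [mul_one] at this
    refine this.congr_of_eventuallyEq (Filter.Eventually.of_forall fun a => ?_)
    simp only [Function.comp, add_assoc, ← add_smul, add_sub_cancel]
  have := is_const_of_deriv_eq_zero (fun s => (hd s).differentiableAt) (fun s => (hd s).deriv) s 0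
  simpa using this

theorem pd_eq_zero_of_shift (hF : DifferentiableAt ℝ F z)
    (h : ∀ s : ℝ, F (z + s • v) = F z) : pd v F z = 0 := by
  have := hasDerivAt_line hF v
  simp only [h] at this
  exact this.unique (hasDerivAt_const _ _)

theorem pd_decomp_full (v z : Pt) : pd v F z = v.1 0 * pd (eS 0) F z + v.1 1 * pd (eS 1) F z
    + v.1 2 * pd (eS 2) F z + v.2 * pd eU F z := by
  have : v = v.1 0 • eS 0 + v.1 1 • eS 1 + v.1 2 • eS 2 + v.2 • eU := by
    ext i
    · fin_cases i <;> simp [eS, eU]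
    · simp [eS, eU]
  conv_lhs => rw [this]
  simp only [pd, map_add, map_smul, smul_eq_mul]

/-- Functions on `I × ℝ³` with the same partial derivatives differ by a constant. -/
theorem eq_add_const (hI : IsOpen I) (hI' : I.OrdConnected) (hF : ContDiffOn ℝ ∞ F (dom I))
    (hG : ContDiffOn ℝ ∞ G (dom I))
    (h0 : ∀ z ∈ dom I, pd (eS 0) F z = pd (eS 0) G z)
    (h1 : ∀ z ∈ dom I, pd (eS 1) F z = pd (eS 1) G z)
    (h2 : ∀ z ∈ dom I, pd (eS 2) F z = pd (eS 2) G z)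
    (h3 : ∀ z ∈ dom I, pd eU F z = pd eU G z) : ∃ c, ∀ z ∈ dom I, F z = G z + c := by
  rcases (dom I).eq_empty_or_nonempty with he | ⟨z₀, hz₀⟩
  · exact ⟨0, by simp [he]⟩
  refine ⟨F z₀ - G z₀, fun z hz => ?_⟩
  have hd : ∀ x ∈ dom I, HasFDerivWithinAt (fun z => F z - G z) (0 : Pt →L[ℝ] ℝ) (dom I) x := by
    intro x hx
    have := (smooth_diffAt hI hF hx).hasFDerivAt.sub (smooth_diffAt hI hG hx).hasFDerivAt
    have e : fderiv ℝ F x - fderiv ℝ G x = 0 := by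
      refine ContinuousLinearMap.ext fun v => ?_
      change pd v F x - pd v G x = 0
      rw [pd_decomp_full, pd_decomp_full (F := G), h0 x hx, h1 x hx, h2 x hx, h3 x hx, sub_self]
    rw [e] at this
    exact this.hasFDerivWithinAt
  have := (convex_dom hI').norm_image_sub_le_of_norm_hasFDerivWithin_le (C := 0) hd
    (by simp) hz₀ hz
  have : F z - G z - (F z₀ - G z₀) = 0 := by simpa using this
  linarith

/-! ### The invariance criterion in terms of partial derivatives -/

/-- The second total derivative `D_y D_y F` at a second-order jet. -/
noncomputable def pdYY (F : Pt → ℝ) (z : Pt) (q r : ℝ) : ℝ :=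
  pd (eS 2) (pd (eS 2) F) z + q * (pd (eS 2) (pd eU F) z + pd eU (pd (eS 2) F) z)
    + q ^ 2 * pd eU (pd eU F) z + r * pd eU F z

/-- D_i F = F_i + u_i F_u is a function on the first jet space. Its derivative is recorded through
its values on vectors, so that `prolong₂_eq` can substitute them without naming the linear map. -/
theorem hasFDerivAt_totalDeriv (hI : IsOpen I) (hF : ContDiffOn ℝ ∞ F (dom I)) (hz : z ∈ dom I)
    (p : Fin 3 → ℝ) (i : Fin 3) : ∃ L : (Pt × (Fin 3 → ℝ)) →L[ℝ] ℝ,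
      HasFDerivAt (fun q : Pt × (Fin 3 → ℝ) => totalDeriv i F q.1 q.2) L (z, p) ∧
      ∀ v c, L (v, c) = pd v (pd (eS i) F) z + p i * pd v (pd eU F) z + c i * pd eU F z := by
  have a1 : HasFDerivAt (fun q : Pt × (Fin 3 → ℝ) => pd (eS i) F q.1) _ (z, p) :=
    HasFDerivAt.comp (g := pd (eS i) F) (f := Prod.fst) (z, p)
      (smooth_diffAt hI (pd_smooth hI (eS i) hF) hz).hasFDerivAt hasFDerivAt_fst
  have a2 : HasFDerivAt (fun q : Pt × (Fin 3 → ℝ) => pd eU F q.1) _ (z, p) :=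
    HasFDerivAt.comp (g := pd eU F) (f := Prod.fst) (z, p)
      (smooth_diffAt hI (pd_smooth hI eU hF) hz).hasFDerivAt hasFDerivAt_fst
  have a3 : HasFDerivAt (fun q : Pt × (Fin 3 → ℝ) => q.2 i) _ (z, p) :=
    ((ContinuousLinearMap.proj (R := ℝ) (φ := fun _ : Fin 3 => ℝ) i).hasFDerivAt).comp (z, p)
      hasFDerivAt_snd
  refine ⟨_, (a1.add (a3.mul a2)).congr_of_eventuallyEq
    (Filter.Eventually.of_forall fun q => totalDeriv_eq i F q.1 q.2), fun v c => ?_⟩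
  simp [pd]
  ring

/-- Only θ^{yy} is needed, because u_yy is the only second derivative in the equation. Of the two
mixed entries, `r k 2` comes from D_y acting on the factor u_k in θ^y and `r 2 k` from the
correction term; they are identified only later, on symmetric jets. -/
theorem prolong₂_eq (hI : IsOpen I) {V : VField} (hV : ContDiffOn ℝ ∞ V (dom I)) (hz : z ∈ dom I)
    (p : Fin 3 → ℝ) (r : Fin 3 → Fin 3 → ℝ) :
    prolong₂ V 2 2 z p r = pdYY (fun z => (V z).2) z (p 2) (r 2 2)
      - ∑ k, (p k * pdYY (fun z => (V z).1 k) z (p 2) (r 2 2)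
        + (r k 2 + r 2 k) * (pd (eS 2) (fun z => (V z).1 k) z
          + p 2 * pd eU (fun z => (V z).1 k) z)) := by
  have hk : ∀ k, ContDiffOn ℝ ∞ (fun z => (V z).1 k) (dom I) := fun k =>
    (contDiffOn_pi.1 hV.fst) k
  have hθ : ContDiffOn ℝ ∞ (fun z => (V z).2) (dom I) := hV.snd
  obtain ⟨L, hL, hL'⟩ := hasFDerivAt_totalDeriv hI hθ hz p 2
  choose M hM hM' using fun k => hasFDerivAt_totalDeriv hI (hk k) hz p 2
  have a3 : ∀ k, HasFDerivAt (fun q : Pt × (Fin 3 → ℝ) => q.2 k)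
      ((ContinuousLinearMap.proj (R := ℝ) (φ := fun _ : Fin 3 => ℝ) k).comp
        (ContinuousLinearMap.snd ℝ Pt (Fin 3 → ℝ))) (z, p) := fun k =>
    ((ContinuousLinearMap.proj (R := ℝ) (φ := fun _ : Fin 3 => ℝ) k).hasFDerivAt).comp (z, p)
      hasFDerivAt_snd
  have key := (hL.sub (HasFDerivAt.fun_sum (u := Finset.univ)
    fun k _ => (a3 k).mul (hM k))).fderiv
  have : totalDerivJet 2 (fun q => prolong₁ V 2 q.1 q.2) z p r
      = fderiv ℝ (fun q : Pt × (Fin 3 → ℝ) => prolong₁ V 2 q.1 q.2) (z, p)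
        ((Pi.single 2 1, p 2), fun k => r k 2) := rfl
  rw [prolong₂, this]
  have e : fderiv ℝ (fun q : Pt × (Fin 3 → ℝ) => prolong₁ V 2 q.1 q.2) (z, p) = _ := key
  rw [e]
  simp only [sub_apply, add_apply, smul_apply, hL', hM', totalDeriv_eq,
    Fin.sum_univ_three, ContinuousLinearMap.comp_apply, ContinuousLinearMap.coe_snd',
    ContinuousLinearMap.proj_apply, smul_eq_mul, pd_decomp, pdYY]
  ring

theorem fderiv_equation {f : ℝ → ℝ} (j w : Jet) (hf : DifferentiableAt ℝ f (j.1.1 0)) :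
    fderiv ℝ (equation f) j w = w.2.1 0
      - (deriv f (j.1.1 0) * w.1.1 0 * j.2.2 2 2 + f (j.1.1 0) * w.2.2 2 2)
      + (w.1.2 * j.2.1 1 + j.1.2 * w.2.1 1) := by
  have line : HasDerivAt (fun h : ℝ => j + h • w) w 0 := by
    simpa using ((hasDerivAt_id (0 : ℝ)).smul_const w).const_add j
  have hlin : ∀ (L : Jet →L[ℝ] ℝ), HasFDerivAt (fun j => L j) L j := fun L => L.hasFDerivAt
  let π := fun k : Fin 3 => ContinuousLinearMap.proj (R := ℝ) (φ := fun _ : Fin 3 => ℝ) k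
  let ρ := ContinuousLinearMap.proj (R := ℝ) (φ := fun _ : Fin 3 => Fin 3 → ℝ) 2
  let L1 : Jet →L[ℝ] Pt := ContinuousLinearMap.fst ℝ _ _
  let L2 : Jet →L[ℝ] ((Fin 3 → ℝ) × (Fin 3 → Fin 3 → ℝ)) := ContinuousLinearMap.snd ℝ _ _
  let Lt : Jet →L[ℝ] ℝ := (π 0).comp ((ContinuousLinearMap.fst ℝ _ _).comp L1)
  let Lu : Jet →L[ℝ] ℝ := (ContinuousLinearMap.snd ℝ _ _).comp L1
  let Lp : Fin 3 → (Jet →L[ℝ] ℝ) := fun k => (π k).comp ((ContinuousLinearMap.fst ℝ _ _).comp L2)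
  let Lr : Jet →L[ℝ] ℝ := (π 2).comp (ρ.comp ((ContinuousLinearMap.snd ℝ _ _).comp L2))
  have hft : HasFDerivAt (fun j : Jet => f (Lt j)) _ j :=
    HasDerivAt.comp_hasFDerivAt (h₂ := f) j hf.hasDerivAt (hlin Lt)
  have := (((hlin (Lp 0)).sub (hft.mul (hlin Lr))).add ((hlin Lu).mul (hlin (Lp 1)))).fderiv
  have e : fderiv ℝ (equation f) j = _ := this
  rw [e]
  simp [Lp, Lt, Lu, Lr, L1, L2, π, ρ]
  ring

end Kolmogorov

namespace Kolmogorov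

variable {I : Set ℝ} {F G : Pt → ℝ} {z v w : Pt} {f : ℝ → ℝ}

/-! ### Characterization of the Lie symmetries -/

/-- The vector fields that can be Lie symmetries of equations of the class; the parameters are
the coefficients of `τ`, the derivative of `η` and the coefficients of the kernel fields. -/
def field (P : Fin 8 → ℝ) : VField := fun z =>
  (![P 0 * z.1 0 ^ 2 + P 1 * z.1 0 + P 2,
     P 0 * z.1 0 * z.1 1 + P 4 * z.1 1 + P 5 * z.1 0 + P 6,
     P 3 * z.1 2 + P 7],
    P 0 * z.1 1 + P 5 + (P 4 - P 1 - P 0 * z.1 0) * z.2)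

/-- The classifying condition `(τ f)' = 2 c f` on `I` for `τ = a₂ t² + a₁ t + a₀`. -/
def Classifying (f : ℝ → ℝ) (I : Set ℝ) (a₂ a₁ a₀ c : ℝ) : Prop :=
  ∀ t ∈ I, HasDerivAt (fun t => (a₂ * t ^ 2 + a₁ * t + a₀) * f t) (2 * c * f t) t

theorem InClass.contDiffAt (hf : InClass f I) {t : ℝ} (ht : t ∈ I) : ContDiffAt ℝ ∞ f t :=
  hf.smooth.contDiffAt (hf.isOpen.mem_nhds ht)

theorem InClass.hasDerivAt (hf : InClass f I) {t : ℝ} (ht : t ∈ I) :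
    HasDerivAt f (deriv f t) t := ((hf.contDiffAt ht).differentiableAt (by simp)).hasDerivAt

theorem classifying_iff (hf : InClass f I) {a₂ a₁ a₀ c : ℝ} : Classifying f I a₂ a₁ a₀ c ↔
    ∀ t ∈ I, (2 * a₂ * t + a₁) * f t + (a₂ * t ^ 2 + a₁ * t + a₀) * deriv f t = 2 * c * f t := by
  have key : ∀ t ∈ I, HasDerivAt (fun t => (a₂ * t ^ 2 + a₁ * t + a₀) * f t)
      ((2 * a₂ * t + a₁) * f t + (a₂ * t ^ 2 + a₁ * t + a₀) * deriv f t) t := by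
    intro t ht
    have h1 : HasDerivAt (fun t : ℝ => a₂ * t ^ 2 + a₁ * t + a₀) (2 * a₂ * t + a₁) t := by
      have := ((((hasDerivAt_id t).pow 2).const_mul a₂).add
        ((hasDerivAt_id t).const_mul a₁)).add_const a₀
      refine this.congr_deriv ?_
      simp; ring
    exact h1.mul (hf.hasDerivAt ht)
  refine ⟨fun h t ht => (key t ht).unique (h t ht), fun h t ht => ?_⟩
  rw [← h t ht]; exact key t ht

/-- The invariance criterion, written out at the jets with `u_x = q`, `u_y = s`, `u_yy = r`,
`u_ty = m`, `u_xy = n` and `u_t = p = f u_yy - u u_x`. -/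
theorem invariance_iff (hf : InClass f I) {V : VField} (hV : ContDiffOn ℝ ∞ V (dom I)) :
    IsLieSymmetry f I V ↔ ∀ z ∈ dom I, ∀ q s r m n p : ℝ, p = f (z.1 0) * r - z.2 * q →
      pd (eS 0) (fun z => (V z).2) z + p * pd eU (fun z => (V z).2) z
      - (p * (pd (eS 0) (fun z => (V z).1 0) z + p * pd eU (fun z => (V z).1 0) z)
        + q * (pd (eS 0) (fun z => (V z).1 1) z + p * pd eU (fun z => (V z).1 1) z)
        + s * (pd (eS 0) (fun z => (V z).1 2) z + p * pd eU (fun z => (V z).1 2) z))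
      - deriv f (z.1 0) * (V z).1 0 * r
      - f (z.1 0) * (pdYY (fun z => (V z).2) z s r
        - (p * pdYY (fun z => (V z).1 0) z s r + 2 * m * (pd (eS 2) (fun z => (V z).1 0) z
            + s * pd eU (fun z => (V z).1 0) z)
          + q * pdYY (fun z => (V z).1 1) z s r + 2 * n * (pd (eS 2) (fun z => (V z).1 1) z
            + s * pd eU (fun z => (V z).1 1) z)
          + s * pdYY (fun z => (V z).1 2) z s r + 2 * r * (pd (eS 2) (fun z => (V z).1 2) z
            + s * pd eU (fun z => (V z).1 2) z)))
      + (V z).2 * q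
      + z.2 * (pd (eS 1) (fun z => (V z).2) z + q * pd eU (fun z => (V z).2) z
      - (p * (pd (eS 1) (fun z => (V z).1 0) z + q * pd eU (fun z => (V z).1 0) z)
        + q * (pd (eS 1) (fun z => (V z).1 1) z + q * pd eU (fun z => (V z).1 1) z)
        + s * (pd (eS 1) (fun z => (V z).1 2) z + q * pd eU (fun z => (V z).1 2) z))) = 0 := by
  constructor
  · rintro ⟨-, h⟩ z hz q s r m n p hp
    have hft := (hf.hasDerivAt (t := z.1 0) hz).differentiableAt
    have := h (z, ![p, q, s], ![![0, 0, m], ![0, 0, n], ![m, n, r]]) hz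
      (by intro i k; fin_cases i <;> fin_cases k <;> rfl) (by simp [equation, hp])
    rw [fderiv_equation _ _ hft] at this
    simp [prolongation, prolong₁, prolong₂_eq hf.isOpen hV hz, totalDeriv_eq,
      Fin.sum_univ_three] at this
    linear_combination this
  · intro h
    refine ⟨hV, ?_⟩
    rintro ⟨z, p, r⟩ hz hs he
    have hft := (hf.hasDerivAt (t := z.1 0) hz).differentiableAt
    have := h z hz (p 1) (p 2) (r 2 2) (r 2 0) (r 2 1) (p 0)
      (by simp only [equation] at he; linear_combination he)
    rw [fderiv_equation _ _ hft]
    simp only [prolongation, prolong₁, prolong₂_eq hf.isOpen hV hz, totalDeriv_eq,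
      Fin.sum_univ_three]
    have e0 : r 0 2 = r 2 0 := hs 0 2
    have e1 : r 1 2 = r 2 1 := hs 1 2
    rw [e0, e1]
    linear_combination this

end Kolmogorov

/-! ### Determining equations and their integration -/

namespace Kolmogorov

variable {I : Set ℝ} {F G : Pt → ℝ} {z v w : Pt} {f : ℝ → ℝ}

theorem pd_pd_eq_zero (hI : IsOpen I) (hF : ContDiffOn ℝ ∞ F (dom I)) {v : Pt}
    (h : ∀ z ∈ dom I, pd v F z = 0) (w : Pt) :
    (∀ z ∈ dom I, pd w (pd v F) z = 0) ∧ ∀ z ∈ dom I, pd v (pd w F) z = 0 := by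
  refine ⟨pd_of_const hI h w, fun z hz => ?_⟩
  rw [pd_comm hI hF hz]
  exact pd_of_const hI h w z hz

/-- A relation `A + h B + h² C = 0` between functions that are constant in the direction of `u`
splits into `A = B = C = 0`. -/
theorem split_eU (hI : IsOpen I) {A B C : Pt → ℝ}
    (hA : ContDiffOn ℝ ∞ A (dom I)) (hB : ContDiffOn ℝ ∞ B (dom I)) (hC : ContDiffOn ℝ ∞ C (dom I))
    (hA' : ∀ z ∈ dom I, pd eU A z = 0) (hB' : ∀ z ∈ dom I, pd eU B z = 0)
    (hC' : ∀ z ∈ dom I, pd eU C z = 0)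
    (h : ∀ z ∈ dom I, A z + z.2 * B z + z.2 ^ 2 * C z = 0) :
    ∀ z ∈ dom I, A z = 0 ∧ B z = 0 ∧ C z = 0 := by
  intro z hz
  have he : (eU).1 0 = 0 := rfl
  have key : ∀ s : ℝ, A z + (z.2 + s) * B z + (z.2 + s) ^ 2 * C z = 0 := by
    intro s
    have := h _ (add_smul_mem_dom hz he s)
    rw [eq_of_pd_eq_zero hI hA he hA' hz, eq_of_pd_eq_zero hI hB he hB' hz,
      eq_of_pd_eq_zero hI hC he hC' hz] at this
    simpa [eU] using this
  -- These shifts along ∂_u move u to 0, 1 and -1; three values determine the quadratic.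
  have k0 := key (-z.2)
  have k1 := key (1 - z.2)
  have k2 := key (-1 - z.2)
  ring_nf at k0 k1 k2
  refine ⟨by linarith, by linarith, by linarith⟩

section
variable (hf : InClass f I) {V : VField}
include hf

/-- The determining equations for the components `T`, `X`, `Y`, `Θ` of a Lie symmetry. -/
theorem determining_equations {T X Y Θ : Pt → ℝ} (hT : ContDiffOn ℝ ∞ T (dom I))
    (hX : ContDiffOn ℝ ∞ X (dom I)) (hY : ContDiffOn ℝ ∞ Y (dom I))
    (hinv : ∀ z ∈ dom I, ∀ q s r m n p : ℝ, p = f (z.1 0) * r - z.2 * q →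
      pd (eS 0) Θ z + p * pd eU Θ z
      - (p * (pd (eS 0) T z + p * pd eU T z)
        + q * (pd (eS 0) X z + p * pd eU X z)
        + s * (pd (eS 0) Y z + p * pd eU Y z))
      - deriv f (z.1 0) * T z * r
      - f (z.1 0) * (pdYY Θ z s r
        - (p * pdYY T z s r + 2 * m * (pd (eS 2) T z + s * pd eU T z)
          + q * pdYY X z s r + 2 * n * (pd (eS 2) X z + s * pd eU X z)
          + s * pdYY Y z s r + 2 * r * (pd (eS 2) Y z + s * pd eU Y z)))
      + Θ z * q
      + z.2 * (pd (eS 1) Θ z + q * pd eU Θ z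
      - (p * (pd (eS 1) T z + q * pd eU T z)
        + q * (pd (eS 1) X z + q * pd eU X z)
        + s * (pd (eS 1) Y z + q * pd eU Y z))) = 0) :
    ∀ z ∈ dom I, pd (eS 2) T z = 0 ∧ pd eU T z = 0 ∧ pd (eS 2) X z = 0 ∧ pd eU X z = 0 ∧
      pd eU Y z = 0 ∧
      2 * f (z.1 0) * pd (eS 2) Y z - pd (eS 0) T z * f (z.1 0) - T z * deriv f (z.1 0)
        - z.2 * f (z.1 0) * pd (eS 1) T z = 0 ∧
      Θ z = pd (eS 0) X z + z.2 * (pd (eS 1) X z - pd (eS 0) T z - z.2 * pd (eS 1) T z) ∧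
      pd (eS 0) Y z + f (z.1 0) * (pd (eS 2) (pd eU Θ) z + pd eU (pd (eS 2) Θ) z)
        - f (z.1 0) * pd (eS 2) (pd (eS 2) Y) z + z.2 * pd (eS 1) Y z = 0 ∧
      pd (eS 0) Θ z - f (z.1 0) * pd (eS 2) (pd (eS 2) Θ) z + z.2 * pd (eS 1) Θ z = 0 := by
  have hI := hf.isOpen
  have hne : ∀ z ∈ dom I, f (z.1 0) ≠ 0 := fun z hz => hf.ne_zero _ hz
  have hTX : ∀ z ∈ dom I, pd (eS 2) T z = 0 ∧ pd eU T z = 0 ∧ pd (eS 2) X z = 0 ∧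
      pd eU X z = 0 := by
    intro z hz
    have h : ∀ s m n : ℝ, m * (pd (eS 2) T z + s * pd eU T z)
        + n * (pd (eS 2) X z + s * pd eU X z) = 0 := by
      intro s m n
      -- m = u_ty and n = u_xy enter linearly, so the difference from m = n = 0 isolates their
      -- coefficients.
      have a := hinv z hz 0 s 0 m n _ rfl
      have b := hinv z hz 0 s 0 0 0 _ rfl
      have : f (z.1 0) * (m * (pd (eS 2) T z + s * pd eU T z)
        + n * (pd (eS 2) X z + s * pd eU X z)) = 0 := by linear_combination (a - b) / 2
      exact (mul_eq_zero.1 this).resolve_left (hne z hz)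
    have h1 := h 0 1 0
    have h2 := h 1 1 0
    have h3 := h 0 0 1
    have h4 := h 1 0 1
    refine ⟨?_, ?_, ?_, ?_⟩ <;> linarith
  have T2 := fun z hz => (hTX z hz).1
  have TU := fun z hz => (hTX z hz).2.1
  have X2 := fun z hz => (hTX z hz).2.2.1
  have XU := fun z hz => (hTX z hz).2.2.2
  have hTYY : ∀ z ∈ dom I, ∀ s r, pdYY T z s r = 0 := by
    intro z hz s r
    simp [pdYY, (pd_pd_eq_zero hI hT T2 (eS 2)).1 z hz, (pd_pd_eq_zero hI hT TU (eS 2)).1 z hz,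
      (pd_pd_eq_zero hI hT TU (eS 2)).2 z hz, (pd_pd_eq_zero hI hT TU eU).1 z hz, TU z hz]
  have hXYY : ∀ z ∈ dom I, ∀ s r, pdYY X z s r = 0 := by
    intro z hz s r
    simp [pdYY, (pd_pd_eq_zero hI hX X2 (eS 2)).1 z hz, (pd_pd_eq_zero hI hX XU (eS 2)).1 z hz,
      (pd_pd_eq_zero hI hX XU (eS 2)).2 z hz, (pd_pd_eq_zero hI hX XU eU).1 z hz, XU z hz]
  have YU : ∀ z ∈ dom I, pd eU Y z = 0 := by
    intro z hz
    have h := fun q s r => hinv z hz q s r 0 0 _ rfl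
    simp only [hTYY z hz, hXYY z hz, hTX z hz] at h
    simp only [pdYY] at h
    -- The second difference in s and r isolates the coefficient of s r, which is 2 f Y_u.
    have h0 := h 0 1 1
    have h1 := h 0 (-1) 1
    have h2 := h 0 1 0
    have h3 := h 0 (-1) 0
    have : f (z.1 0) * pd eU Y z = 0 := by linear_combination (h0 - h1 - h2 + h3) / 4
    exact (mul_eq_zero.1 this).resolve_left (hne z hz)
  intro z hz
  have h := fun q s r => hinv z hz q s r 0 0 _ rfl
  simp only [hTYY z hz, hXYY z hz, hTX z hz] at h
  simp only [pdYY, YU z hz,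
    (pd_pd_eq_zero hI hY YU (eS 2)).1 z hz, (pd_pd_eq_zero hI hY YU (eS 2)).2 z hz,
    (pd_pd_eq_zero hI hY YU eU).1 z hz] at h
  -- What is left is a polynomial in q, s, r. Its constant term, its coefficients of r and q, and
  -- its part odd in s give the four remaining equations.
  have h000 := h 0 0 0
  have h100 := h 1 0 0
  have h001 := h 0 0 1
  have h010 := h 0 1 0
  have h010' := h 0 (-1) 0
  refine ⟨T2 z hz, TU z hz, X2 z hz, XU z hz, YU z hz, ?_, ?_, ?_, ?_⟩
  · linear_combination h001 - h000
  · linear_combination h100 - h000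
  · linear_combination (h010' - h010) / 2
  · linear_combination h000

end

theorem smooth_snd : ContDiffOn ℝ ∞ (fun z : Pt => z.2) (dom I) := by
  fun_prop

/-- Derivative of a polynomial in `(t, x, y, u)` of the shape of the components of `field`. -/
theorem pd_poly (a b c d e k l m : ℝ) (v z : Pt) :
    pd v (fun z => a * z.1 0 ^ 2 + b * (z.1 0 * z.1 1) + c * z.1 0 + d * z.1 1 + e * z.1 2
      + k * z.2 + l * (z.1 0 * z.2) + m) z
    = a * (2 * z.1 0 * v.1 0) + b * (v.1 0 * z.1 1 + z.1 0 * v.1 1) + c * v.1 0 + d * v.1 1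
      + e * v.1 2 + k * v.2 + l * (v.1 0 * z.2 + z.1 0 * v.2) := by
  have hk : ∀ k : Fin 3, HasFDerivAt (fun z : Pt => z.1 k)
      ((ContinuousLinearMap.proj (R := ℝ) (φ := fun _ : Fin 3 => ℝ) k).comp
        (ContinuousLinearMap.fst ℝ (Fin 3 → ℝ) ℝ)) z := fun k =>
    ((ContinuousLinearMap.proj (R := ℝ) (φ := fun _ : Fin 3 => ℝ) k).hasFDerivAt).comp z
      hasFDerivAt_fst
  have hu : HasFDerivAt (fun z : Pt => z.2) (ContinuousLinearMap.snd ℝ (Fin 3 → ℝ) ℝ) z :=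
    hasFDerivAt_snd
  have := (((((((((hk 0).pow 2).const_mul a).add (((hk 0).mul (hk 1)).const_mul b)).add
    ((hk 0).const_mul c)).add ((hk 1).const_mul d)).add ((hk 2).const_mul e)).add
    (hu.const_mul k)).add (((hk 0).mul hu).const_mul l)).add_const m
  have e : fderiv ℝ (fun z : Pt => a * z.1 0 ^ 2 + b * (z.1 0 * z.1 1) + c * z.1 0 + d * z.1 1
      + e * z.1 2 + k * z.2 + l * (z.1 0 * z.2) + m) z = _ := this.fderiv
  rw [pd, e]
  simp
  ring

theorem smooth_poly (a b c d e k l m : ℝ) :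
    ContDiffOn ℝ ∞ (fun z : Pt => a * z.1 0 ^ 2 + b * (z.1 0 * z.1 1) + c * z.1 0 + d * z.1 1
      + e * z.1 2 + k * z.2 + l * (z.1 0 * z.2) + m) (dom I) := by
  fun_prop

/-- Integration of a system `∂_i F = ...` whose right-hand sides are linear functions. -/
theorem eq_poly (hI : IsOpen I) (hI' : I.OrdConnected) (hF : ContDiffOn ℝ ∞ F (dom I))
    (a b c d e : ℝ)
    (h0 : ∀ z ∈ dom I, pd (eS 0) F z = 2 * a * z.1 0 + b * z.1 1 + c)
    (h1 : ∀ z ∈ dom I, pd (eS 1) F z = b * z.1 0 + d)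
    (h2 : ∀ z ∈ dom I, pd (eS 2) F z = e)
    (h3 : ∀ z ∈ dom I, pd eU F z = 0) : ∃ m, ∀ z ∈ dom I,
      F z = a * z.1 0 ^ 2 + b * (z.1 0 * z.1 1) + c * z.1 0 + d * z.1 1 + e * z.1 2 + m := by
  obtain ⟨m, hm⟩ := eq_add_const hI hI' hF (smooth_poly a b c d e 0 0 0)
    (fun z hz => by rw [h0 z hz, pd_poly]; simp [eS]; ring)
    (fun z hz => by rw [h1 z hz, pd_poly]; simp [eS])
    (fun z hz => by rw [h2 z hz, pd_poly]; simp [eS])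
    (fun z hz => by rw [h3 z hz, pd_poly]; simp [eU])
  exact ⟨m, fun z hz => by rw [hm z hz]; ring⟩

theorem pd_add_mul_snd (hI : IsOpen I) {A B : Pt → ℝ} (hA : ContDiffOn ℝ ∞ A (dom I))
    (hB : ContDiffOn ℝ ∞ B (dom I)) (hF : ∀ z ∈ dom I, F z = A z + z.2 * B z) (v : Pt) :
    ∀ z ∈ dom I, pd v F z = pd v A z + v.2 * B z + z.2 * pd v B z := by
  intro z hz
  rw [pd_congr hI hF v hz]
  have hu : HasFDerivAt (fun z : Pt => z.2) (ContinuousLinearMap.snd ℝ (Fin 3 → ℝ) ℝ) z :=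
    hasFDerivAt_snd
  have e : fderiv ℝ (fun z : Pt => A z + z.2 * B z) z = _ :=
    ((smooth_diffAt hI hA hz).hasFDerivAt.add
      (hu.mul (smooth_diffAt hI hB hz).hasFDerivAt)).fderiv
  simp only [pd, e]
  simp
  ring

theorem pd_sub' (hI : IsOpen I) {A B : Pt → ℝ} (hA : ContDiffOn ℝ ∞ A (dom I))
    (hB : ContDiffOn ℝ ∞ B (dom I)) (hz : z ∈ dom I) (v : Pt) :
    pd v (fun z => A z - B z) z = pd v A z - pd v B z := by
  have e : fderiv ℝ (fun z : Pt => A z - B z) z = _ :=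
    ((smooth_diffAt hI hA hz).hasFDerivAt.sub (smooth_diffAt hI hB hz).hasFDerivAt).fderiv
  simp only [pd, e]
  simp

/-- The equation tying Y_y to T and f is affine in u with slope -f T_x, hence T_x = 0, and then Y_y
depends on t alone. Splitting the last two equations by powers of u gives Y_t = Y_x = 0, X_tt = X_xx
= 0 and 2 X_tx = T_tt. All derivatives of X_tx vanish, so it is a constant a, and repeated
integration produces the polynomials of `field`. What remains of the first equation is the
classifying condition. -/
theorem solve_determining_equations (hf : InClass f I) {T X Y Θ : Pt → ℝ}
    (hT : ContDiffOn ℝ ∞ T (dom I)) (hX : ContDiffOn ℝ ∞ X (dom I))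
    (hY : ContDiffOn ℝ ∞ Y (dom I))
    (h : ∀ z ∈ dom I, pd (eS 2) T z = 0 ∧ pd eU T z = 0 ∧ pd (eS 2) X z = 0 ∧ pd eU X z = 0 ∧
      pd eU Y z = 0 ∧
      2 * f (z.1 0) * pd (eS 2) Y z - pd (eS 0) T z * f (z.1 0) - T z * deriv f (z.1 0)
        - z.2 * f (z.1 0) * pd (eS 1) T z = 0 ∧
      Θ z = pd (eS 0) X z + z.2 * (pd (eS 1) X z - pd (eS 0) T z - z.2 * pd (eS 1) T z) ∧
      pd (eS 0) Y z + f (z.1 0) * (pd (eS 2) (pd eU Θ) z + pd eU (pd (eS 2) Θ) z)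
        - f (z.1 0) * pd (eS 2) (pd (eS 2) Y) z + z.2 * pd (eS 1) Y z = 0 ∧
      pd (eS 0) Θ z - f (z.1 0) * pd (eS 2) (pd (eS 2) Θ) z + z.2 * pd (eS 1) Θ z = 0) :
    ∃ P : Fin 8 → ℝ, Classifying f I (P 0) (P 1) (P 2) (P 3) ∧
      ∀ z ∈ dom I, T z = ((field P) z).1 0 ∧ X z = ((field P) z).1 1 ∧ Y z = ((field P) z).1 2 ∧
        Θ z = ((field P) z).2 := by
  have hI := hf.isOpen
  have hI' := hf.ordConnected
  have hne : ∀ z ∈ dom I, f (z.1 0) ≠ 0 := fun z hz => hf.ne_zero _ hz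
  have T2 := fun z hz => (h z hz).1
  have TU := fun z hz => (h z hz).2.1
  have X2 := fun z hz => (h z hz).2.2.1
  have XU := fun z hz => (h z hz).2.2.2.1
  have YU := fun z hz => (h z hz).2.2.2.2.1
  have he : (eU).1 0 = 0 := rfl
  have he1 : (eS 1).1 0 = 0 := rfl
  have he2 : (eS 2).1 0 = 0 := rfl
  have sm : ∀ {F : Pt → ℝ}, ContDiffOn ℝ ∞ F (dom I) → ∀ v, ContDiffOn ℝ ∞ (pd v F) (dom I) :=
    fun hF v => pd_smooth hI v hF
  have T1 : ∀ z ∈ dom I, pd (eS 1) T z = 0 := by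
    intro z hz
    have a := (h z hz).2.2.2.2.2.1
    have b := (h _ (add_smul_mem_dom hz he 1)).2.2.2.2.2.1
    rw [eq_of_pd_eq_zero hI (sm hT _) he (pd_pd_eq_zero hI hT TU _).2 hz,
      eq_of_pd_eq_zero hI (sm hT _) he (pd_pd_eq_zero hI hT TU _).2 hz,
      eq_of_pd_eq_zero hI (sm hY _) he (pd_pd_eq_zero hI hY YU _).2 hz,
      eq_of_pd_eq_zero hI hT he TU hz] at b
    simp [eU] at b
    have : f (z.1 0) * pd (eS 1) T z = 0 := by linear_combination a - b
    exact (mul_eq_zero.1 this).resolve_left (hne z hz)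
  have hc : ∀ z ∈ dom I, 2 * f (z.1 0) * pd (eS 2) Y z - pd (eS 0) T z * f (z.1 0)
      - T z * deriv f (z.1 0) = 0 := fun z hz => by
    have a := (h z hz).2.2.2.2.2.1
    rw [T1 z hz] at a
    linear_combination a
  have Y22 : ∀ v : Pt, v.1 0 = 0 → (∀ z ∈ dom I, pd v T z = 0) →
      ∀ z ∈ dom I, pd v (pd (eS 2) Y) z = 0 := by
    intro v hv hTv z hz
    -- A shift along v changes neither t nor T nor T_t, so the equation gives the same value of Y_y;
    -- f' need not be differentiated.
    refine pd_eq_zero_of_shift (smooth_diffAt hI (sm hY _) hz) fun s => ?_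
    have a := hc z hz
    have b := hc _ (add_smul_mem_dom hz hv s)
    rw [eq_of_pd_eq_zero hI (sm hT _) hv (pd_pd_eq_zero hI hT hTv _).2 hz,
      eq_of_pd_eq_zero hI hT hv hTv hz] at b
    simp [hv] at b
    have : f (z.1 0) * (pd (eS 2) Y (z + s • v) - pd (eS 2) Y z) = 0 := by
      linear_combination (b - a) / 2
    linarith [(mul_eq_zero.1 this).resolve_left (hne z hz)]
  have hΘ : ∀ z ∈ dom I, Θ z = pd (eS 0) X z + z.2 * (pd (eS 1) X z - pd (eS 0) T z) := by
    intro z hz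
    rw [(h z hz).2.2.2.2.2.2.1, T1 z hz]; ring
  have hB : ContDiffOn ℝ ∞ (fun z => pd (eS 1) X z - pd (eS 0) T z) (dom I) :=
    (sm hX _).sub (sm hT _)
  have dΘ : ∀ v, ∀ z ∈ dom I, pd v Θ z = pd v (pd (eS 0) X) z
      + v.2 * (pd (eS 1) X z - pd (eS 0) T z)
      + z.2 * (pd v (pd (eS 1) X) z - pd v (pd (eS 0) T) z) := by
    intro v z hz
    rw [pd_add_mul_snd hI (sm hX _) hB hΘ v z hz, pd_sub' hI (sm hX _) (sm hT _) hz]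
  have Θ2 : ∀ z ∈ dom I, pd (eS 2) Θ z = 0 := by
    intro z hz
    rw [dΘ _ z hz, (pd_pd_eq_zero hI hX X2 _).2 z hz, (pd_pd_eq_zero hI hX X2 _).2 z hz,
      (pd_pd_eq_zero hI hT T2 _).2 z hz]
    simp [eS]
  have ΘS : ContDiffOn ℝ ∞ Θ (dom I) := by
    refine ContDiffOn.congr ?_ hΘ
    exact (sm hX _).add (smooth_snd.mul hB)
  have hY01 : ∀ z ∈ dom I, pd (eS 0) Y z = 0 ∧ pd (eS 1) Y z = 0 := by
    intro z hz
    have := split_eU hI (sm hY (eS 0)) (sm hY (eS 1)) (contDiffOn_const (c := (0 : ℝ)))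
      (pd_pd_eq_zero hI hY YU _).2 (pd_pd_eq_zero hI hY YU _).2 (pd_of_const hI (fun _ _ => rfl) _)
      (fun z hz => by
        have a := (h z hz).2.2.2.2.2.2.2.1
        rw [(pd_pd_eq_zero hI ΘS Θ2 _).1 z hz, (pd_pd_eq_zero hI ΘS Θ2 _).2 z hz,
          Y22 _ he2 T2 z hz] at a
        linear_combination a) z hz
    exact ⟨this.1, this.2.1⟩
  have hX01 : ∀ z ∈ dom I, pd (eS 0) (pd (eS 0) X) z = 0 ∧
      2 * pd (eS 0) (pd (eS 1) X) z = pd (eS 0) (pd (eS 0) T) z ∧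
      pd (eS 1) (pd (eS 1) X) z = 0 := by
    intro z hz
    have u2 : ∀ {F : Pt → ℝ}, ContDiffOn ℝ ∞ F (dom I) → (∀ z ∈ dom I, pd eU F z = 0) →
        ∀ v w, ∀ z ∈ dom I, pd eU (pd v (pd w F)) z = 0 := fun hF hU v w =>
      (pd_pd_eq_zero hI (sm hF w) (pd_pd_eq_zero hI hF hU w).2 v).2
    have := split_eU hI (A := pd (eS 0) (pd (eS 0) X))
      (B := fun z => pd (eS 1) (pd (eS 0) X) z -
        (pd (eS 0) (pd (eS 0) T) z - pd (eS 0) (pd (eS 1) X) z))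
      (C := pd (eS 1) (pd (eS 1) X))
      (sm (sm hX _) _) ((sm (sm hX _) _).sub ((sm (sm hT _) _).sub (sm (sm hX _) _)))
      (sm (sm hX _) _) (u2 hX XU _ _)
      (fun z hz => by
        rw [pd_sub' hI (sm (sm hX _) _) ((sm (sm hT _) _).sub (sm (sm hX _) _)) hz,
          pd_sub' hI (sm (sm hT _) _) (sm (sm hX _) _) hz, u2 hX XU _ _ z hz, u2 hX XU _ _ z hz,
          u2 hT TU _ _ z hz]
        simp)
      (u2 hX XU _ _)
      (fun z hz => by
        have a := (h z hz).2.2.2.2.2.2.2.2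
        rw [(pd_pd_eq_zero hI ΘS Θ2 _).1 z hz, dΘ _ z hz, dΘ _ z hz,
          (pd_pd_eq_zero hI hT T1 _).2 z hz] at a
        simp [eS] at a
        simp only [eS]
        linear_combination a) z hz
    refine ⟨this.1, ?_, this.2.2⟩
    have a := this.2.1
    rw [pd_comm hI hX hz] at a
    linear_combination a
  have X11 := fun z hz => (hX01 z hz).2.2
  have X00 := fun z hz => (hX01 z hz).1
  have X01 : ∀ z ∈ dom I, 2 * pd (eS 0) (pd (eS 1) X) z = pd (eS 0) (pd (eS 0) T) z :=
    fun z hz => (hX01 z hz).2.1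
  have X001 : ∀ z ∈ dom I, pd (eS 0) (pd (eS 0) (pd (eS 1) X)) z = 0 := by
    intro z hz
    rw [pd_congr hI (fun z hz => pd_comm hI hX hz (eS 0) (eS 1)) _ hz,
      (pd_pd_eq_zero hI (sm hX _) X00 _).2 z hz]
  have X01c : ∃ a, ∀ z ∈ dom I, pd (eS 0) (pd (eS 1) X) z = a := by
    obtain ⟨m, hm⟩ := eq_poly hI hI' (sm (sm hX (eS 1)) (eS 0)) 0 0 0 0 0
      (fun z hz => by rw [X001 z hz]; ring)
      (fun z hz => by rw [(pd_pd_eq_zero hI (sm hX _) X11 _).2 z hz]; ring)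
      (fun z hz => by
        rw [(pd_pd_eq_zero hI (sm hX _) (pd_pd_eq_zero hI hX X2 (eS 1)).2 (eS 0)).2 z hz])
      (fun z hz => by
        rw [(pd_pd_eq_zero hI (sm hX _) (pd_pd_eq_zero hI hX XU (eS 1)).2 (eS 0)).2 z hz])
    exact ⟨m, fun z hz => by rw [hm z hz]; ring⟩
  obtain ⟨a, ha⟩ := X01c
  have T00 : ∀ z ∈ dom I, pd (eS 0) (pd (eS 0) T) z = 2 * a := fun z hz => by
    rw [← X01 z hz, ha z hz]
  obtain ⟨b, hb⟩ := eq_poly hI hI' (sm hT (eS 0)) 0 0 (2 * a) 0 0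
    (fun z hz => by rw [T00 z hz]; ring)
    (fun z hz => by rw [(pd_pd_eq_zero hI hT T1 _).2 z hz]; ring)
    (fun z hz => (pd_pd_eq_zero hI hT T2 _).2 z hz)
    (fun z hz => (pd_pd_eq_zero hI hT TU _).2 z hz)
  obtain ⟨c, hTc⟩ := eq_poly hI hI' hT a 0 b 0 0 (fun z hz => by rw [hb z hz]; ring)
    (fun z hz => by rw [T1 z hz]; ring) T2 TU
  obtain ⟨k, hk⟩ := eq_poly hI hI' (sm hY (eS 2)) 0 0 0 0 0
    (fun z hz => by rw [(pd_pd_eq_zero hI hY (fun z hz => (hY01 z hz).1) _).2 z hz]; ring)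
    (fun z hz => by rw [(pd_pd_eq_zero hI hY (fun z hz => (hY01 z hz).2) _).2 z hz]; ring)
    (fun z hz => Y22 _ he2 T2 z hz) (fun z hz => Y22 _ he TU z hz)
  obtain ⟨l, hl⟩ := eq_poly hI hI' hY 0 0 0 0 k
    (fun z hz => by rw [(hY01 z hz).1]; ring) (fun z hz => by rw [(hY01 z hz).2]; ring)
    (fun z hz => by rw [hk z hz]; ring) YU
  obtain ⟨m, hm⟩ := eq_poly hI hI' (sm hX (eS 1)) 0 0 a 0 0
    (fun z hz => by rw [ha z hz]; ring)
    (fun z hz => by rw [X11 z hz]; ring)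
    (fun z hz => (pd_pd_eq_zero hI hX X2 _).2 z hz)
    (fun z hz => (pd_pd_eq_zero hI hX XU _).2 z hz)
  obtain ⟨n, hn⟩ := eq_poly hI hI' (sm hX (eS 0)) 0 0 0 a 0
    (fun z hz => by rw [X00 z hz]; ring)
    (fun z hz => by rw [pd_comm hI hX hz, ha z hz]; ring)
    (fun z hz => (pd_pd_eq_zero hI hX X2 _).2 z hz)
    (fun z hz => (pd_pd_eq_zero hI hX XU _).2 z hz)
  obtain ⟨o, ho⟩ := eq_poly hI hI' hX 0 a n m 0
    (fun z hz => by rw [hn z hz]; ring) (fun z hz => by rw [hm z hz]; ring) X2 XU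
  refine ⟨![a, b, c, k, m, n, o, l], ?_, fun z hz => ⟨?_, ?_, ?_, ?_⟩⟩
  · rw [classifying_iff hf]
    intro t ht
    have hz : ((![t, 0, 0], 0) : Pt) ∈ dom I := ht
    have := hc _ hz
    rw [hk _ hz, hb _ hz, hTc _ hz] at this
    simp at this ⊢
    linear_combination -this
  · rw [hTc z hz]; simp [field]
  · rw [ho z hz]; simp [field]; ring
  · rw [hl z hz]; simp [field]
  · rw [hΘ z hz, hn z hz, hm z hz, hb z hz]; simp [field]; ring

end Kolmogorov

/-! ### Sufficiency of the classifying condition, and the Lie bracket -/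

namespace Kolmogorov

variable {I : Set ℝ} {F G : Pt → ℝ} {z v w : Pt} {f : ℝ → ℝ}

/-- The polynomial has no term of degree two in (y, u), so only u_yy F_u survives in D_y D_y F. -/
theorem pdYY_poly (hI : IsOpen I) {a b c d e k l m : ℝ}
    (h : Set.EqOn F (fun z => a * z.1 0 ^ 2 + b * (z.1 0 * z.1 1) + c * z.1 0 + d * z.1 1
      + e * z.1 2 + k * z.2 + l * (z.1 0 * z.2) + m) (dom I)) (hz : z ∈ dom I) (s r : ℝ) :
    pdYY F z s r = r * (k + l * z.1 0) := by
  have h2 : Set.EqOn (pd (eS 2) F) (fun _ => e) (dom I) := fun z hz => by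
    rw [pd_congr hI h _ hz, pd_poly]; simp [eS]
  have hU : Set.EqOn (pd eU F) (fun z => 0 * z.1 0 ^ 2 + 0 * (z.1 0 * z.1 1) + l * z.1 0
      + 0 * z.1 1 + 0 * z.1 2 + 0 * z.2 + 0 * (z.1 0 * z.2) + k) (dom I) := fun z hz => by
    rw [pd_congr hI h _ hz, pd_poly]; simp [eU]; ring
  rw [pdYY, pd_of_const hI h2 _ z hz, pd_of_const hI h2 _ z hz, pd_congr hI hU _ hz,
    pd_congr hI hU _ hz, pd_poly, pd_poly, hU hz]
  simp [eS, eU]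
  exact Or.inl (by ring)

theorem smooth_field (P : Fin 8 → ℝ) : ContDiffOn ℝ ∞ (field P) (dom I) := by
  refine ContDiffOn.prodMk (contDiffOn_pi.2 fun k => ?_) (by fun_prop)
  fin_cases k <;> simp <;> fun_prop

/-- Necessity is the integrated determining system. Conversely, for the fields `field P` the whole
criterion collapses to -u_yy times the classifying condition. -/
theorem isLieSymmetry_iff (hf : InClass f I) {V : VField} : IsLieSymmetry f I V ↔
    ∃ P : Fin 8 → ℝ, Classifying f I (P 0) (P 1) (P 2) (P 3) ∧
      Set.EqOn V (field P) (dom I) := by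
  have hI := hf.isOpen
  constructor
  · intro h
    have hV := h.1
    have hk : ∀ k, ContDiffOn ℝ ∞ (fun z => (V z).1 k) (dom I) := fun k =>
      (contDiffOn_pi.1 hV.fst) k
    obtain ⟨P, hP, hP'⟩ := solve_determining_equations hf (hk 0) (hk 1) (hk 2)
      (determining_equations hf (hk 0) (hk 1) (hk 2) ((invariance_iff hf hV).1 h))
    refine ⟨P, hP, fun z hz => Prod.ext (funext fun k => ?_) (hP' z hz).2.2.2⟩
    fin_cases k
    · exact (hP' z hz).1
    · exact (hP' z hz).2.1
    · exact (hP' z hz).2.2.1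
  · rintro ⟨P, hP, hV⟩
    have hVs : ContDiffOn ℝ ∞ V (dom I) := (smooth_field P).congr hV
    rw [invariance_iff hf hVs]
    intro z hz q s r m n p hp
    have h0 : Set.EqOn (fun z => (V z).1 0) (fun z => P 0 * z.1 0 ^ 2 + 0 * (z.1 0 * z.1 1)
        + P 1 * z.1 0 + 0 * z.1 1 + 0 * z.1 2 + 0 * z.2 + 0 * (z.1 0 * z.2) + P 2) (dom I) :=
      fun z hz => by simp [hV hz, field]
    have h1 : Set.EqOn (fun z => (V z).1 1) (fun z => 0 * z.1 0 ^ 2 + P 0 * (z.1 0 * z.1 1)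
        + P 5 * z.1 0 + P 4 * z.1 1 + 0 * z.1 2 + 0 * z.2 + 0 * (z.1 0 * z.2) + P 6) (dom I) :=
      fun z hz => by simp [hV hz, field]; ring
    have h2 : Set.EqOn (fun z => (V z).1 2) (fun z => 0 * z.1 0 ^ 2 + 0 * (z.1 0 * z.1 1)
        + 0 * z.1 0 + 0 * z.1 1 + P 3 * z.1 2 + 0 * z.2 + 0 * (z.1 0 * z.2) + P 7) (dom I) :=
      fun z hz => by simp [hV hz, field]
    have h3 : Set.EqOn (fun z => (V z).2) (fun z => 0 * z.1 0 ^ 2 + 0 * (z.1 0 * z.1 1)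
        + 0 * z.1 0 + P 0 * z.1 1 + 0 * z.1 2 + (P 4 - P 1) * z.2 + (-P 0) * (z.1 0 * z.2)
        + P 5) (dom I) :=
      fun z hz => by simp [hV hz, field]; ring
    have hc := (classifying_iff hf).1 hP (z.1 0) hz
    rw [pdYY_poly hI h0 hz, pdYY_poly hI h1 hz, pdYY_poly hI h2 hz, pdYY_poly hI h3 hz]
    simp only [pd_congr hI h0 _ hz, pd_congr hI h1 _ hz, pd_congr hI h2 _ hz,
      pd_congr hI h3 _ hz, pd_poly]
    rw [hV hz, hp]
    simp [eS, eU, field]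
    linear_combination -r * hc

/-- A cubic polynomial that vanishes on a nonempty open set is zero. -/
theorem cubic_eq_zero (hI : IsOpen I) (hne : I.Nonempty) {a b c d : ℝ}
    (h : ∀ t ∈ I, a * t ^ 3 + b * t ^ 2 + c * t + d = 0) : a = 0 ∧ b = 0 ∧ c = 0 ∧ d = 0 := by
  have hinf : I.Infinite := by
    obtain ⟨t, ht⟩ := hne
    exact infinite_of_mem_nhds t (hI.mem_nhds ht)
  let p : Polynomial ℝ := .C a * .X ^ 3 + .C b * .X ^ 2 + .C c * .X + .C d
  have hp : p = 0 := Polynomial.eq_zero_of_infinite_isRoot p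
    (hinf.mono fun t ht => by simpa [p, Polynomial.IsRoot] using h t ht)
  have hk : ∀ n, p.coeff n = 0 := by simp [hp]
  have h0 := hk 0
  have h1 := hk 1
  have h2 := hk 2
  have h3 := hk 3
  simp [p, Polynomial.coeff_X, Polynomial.coeff_C] at h0 h1 h2 h3
  exact ⟨h3, h2, h1, h0⟩

/-- Eliminating f' from (τ₁ f)' = 2 c₁ f and (τ₂ f)' = 2 c₂ f gives τ₁ τ₂' - τ₂ τ₁' = 2 (c₂ τ₁ - c₁
τ₂). The t-component of the bracket is therefore a combination of τ₁ and τ₂, and its product with f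
has derivative 4 (c₂ c₁ - c₁ c₂) f = 0. So the bracket solves the classifying condition with c = 0,
in accordance with the bracket of two affine fields in y being constant. -/
theorem isLieSymmetry_lieBracket (hf : InClass f I) {V W : VField} (hV : IsLieSymmetry f I V)
    (hW : IsLieSymmetry f I W) : IsLieSymmetry f I (VectorField.lieBracket ℝ V W) := by
  have hI := hf.isOpen
  obtain ⟨P, hP, hVP⟩ := (isLieSymmetry_iff hf).1 hV
  obtain ⟨R, hR, hWR⟩ := (isLieSymmetry_iff hf).1 hW
  rw [isLieSymmetry_iff hf]
  rw [classifying_iff hf] at hP hR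
  obtain ⟨-, e0, e1, e2⟩ := cubic_eq_zero hI hf.nonempty (a := 0)
    (b := P 1 * R 0 - P 0 * R 1 - 2 * (R 3 * P 0 - P 3 * R 0))
    (c := 2 * (P 2 * R 0 - P 0 * R 2) - 2 * (R 3 * P 1 - P 3 * R 1))
    (d := P 2 * R 1 - P 1 * R 2 - 2 * (R 3 * P 2 - P 3 * R 2)) (fun t ht => by
      have := mul_left_cancel₀ (hf.ne_zero t ht) (b := (P 0 * t ^ 2 + P 1 * t + P 2) *
        (2 * R 0 * t + R 1) - (R 0 * t ^ 2 + R 1 * t + R 2) * (2 * P 0 * t + P 1))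
        (c := 2 * (R 3 * (P 0 * t ^ 2 + P 1 * t + P 2) - P 3 * (R 0 * t ^ 2 + R 1 * t + R 2)))
        (by linear_combination (P 0 * t ^ 2 + P 1 * t + P 2) * hR t ht
              - (R 0 * t ^ 2 + R 1 * t + R 2) * hP t ht)
      linear_combination this)
  refine ⟨![P 1 * R 0 - P 0 * R 1, 2 * (P 2 * R 0 - P 0 * R 2), P 2 * R 1 - P 1 * R 2, 0,
    P 2 * R 0 - R 2 * P 0, P 1 * R 5 + P 5 * R 4 + P 6 * R 0 - (R 1 * P 5 + R 5 * P 4 + R 6 * P 0),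
    P 2 * R 5 + P 6 * R 4 - R 2 * P 5 - R 6 * P 4, P 7 * R 3 - P 3 * R 7], ?_, fun z hz => ?_⟩
  · rw [classifying_iff hf]
    intro t ht
    simp
    linear_combination (2 * t * f t + t ^ 2 * deriv f t) * e0 + (f t + t * deriv f t) * e1
      + deriv f t * e2 + 2 * R 3 * hP t ht - 2 * P 3 * hR t ht
  · have comp : ∀ {V : VField} {P : Fin 8 → ℝ}, IsLieSymmetry f I V → Set.EqOn V (field P) (dom I) →
        ∀ v, fderiv ℝ V z v = (![(2 * P 0 * z.1 0 + P 1) * v.1 0,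
          (P 0 * z.1 1 + P 5) * v.1 0 + (P 0 * z.1 0 + P 4) * v.1 1, P 3 * v.1 2],
          P 0 * v.1 1 + (P 4 - P 1 - P 0 * z.1 0) * v.2 - P 0 * v.1 0 * z.2) := by
      intro V P hVs hV v
      have h0 : Set.EqOn (fun z => (V z).1 0) (fun z => P 0 * z.1 0 ^ 2 + 0 * (z.1 0 * z.1 1)
          + P 1 * z.1 0 + 0 * z.1 1 + 0 * z.1 2 + 0 * z.2 + 0 * (z.1 0 * z.2) + P 2) (dom I) :=
        fun z hz => by simp [hV hz, field]
      have h1 : Set.EqOn (fun z => (V z).1 1) (fun z => 0 * z.1 0 ^ 2 + P 0 * (z.1 0 * z.1 1)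
          + P 5 * z.1 0 + P 4 * z.1 1 + 0 * z.1 2 + 0 * z.2 + 0 * (z.1 0 * z.2) + P 6) (dom I) :=
        fun z hz => by simp [hV hz, field]; ring
      have h2 : Set.EqOn (fun z => (V z).1 2) (fun z => 0 * z.1 0 ^ 2 + 0 * (z.1 0 * z.1 1)
          + 0 * z.1 0 + 0 * z.1 1 + P 3 * z.1 2 + 0 * z.2 + 0 * (z.1 0 * z.2) + P 7) (dom I) :=
        fun z hz => by simp [hV hz, field]
      have h3 : Set.EqOn (fun z => (V z).2) (fun z => 0 * z.1 0 ^ 2 + 0 * (z.1 0 * z.1 1)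
          + 0 * z.1 0 + P 0 * z.1 1 + 0 * z.1 2 + (P 4 - P 1) * z.2 + (-P 0) * (z.1 0 * z.2)
          + P 5) (dom I) :=
        fun z hz => by simp [hV hz, field]; ring
      have hd : HasFDerivAt V (fderiv ℝ V z) z :=
        ((hVs.1.contDiffAt ((isOpen_dom hI).mem_nhds hz)).differentiableAt (by simp)).hasFDerivAt
      have hk : ∀ k, (fderiv ℝ V z v).1 k = pd v (fun z => (V z).1 k) z := fun k => by
        have := (hasFDerivAt_pi'.1 hd.fst k).fderiv
        simp [pd, this]
      have hu : (fderiv ℝ V z v).2 = pd v (fun z => (V z).2) z := by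
        have := hd.snd.fderiv
        simp [pd, this]
      refine Prod.ext (funext fun k => ?_) ?_
      · rw [hk]
        fin_cases k
        · refine (pd_congr hI h0 v hz).trans ?_
          rw [pd_poly]; simp; ring
        · refine (pd_congr hI h1 v hz).trans ?_
          rw [pd_poly]; simp; ring
        · refine (pd_congr hI h2 v hz).trans ?_
          rw [pd_poly]; simp
      · rw [hu, pd_congr hI h3 v hz, pd_poly]; simp; ring
    rw [VectorField.lieBracket, comp hV hVP, comp hW hWR, hVP hz, hWR hz]
    refine Prod.ext (funext fun k => ?_) ?_
    · fin_cases k <;> simp [field] <;> ring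
    · simp [field]; ring

end Kolmogorov

namespace Kolmogorov

variable {I : Set ℝ} {F G : Pt → ℝ} {z v w : Pt} {f : ℝ → ℝ}

/-! ### Bases of the maximal Lie invariance algebras -/

/-- A single t suffices: the coefficients of x and u in θ and of x in ξ expose `P 0`, `P 4` and `P
1`, after which the value of τ at t gives `P 2`. -/
theorem field_injective (hne : I.Nonempty) {P R : Fin 8 → ℝ}
    (h : Set.EqOn (field P) (field R) (dom I)) : P = R := by
  obtain ⟨t, ht⟩ := hne
  have key : ∀ x y u : ℝ, field P (![t, x, y], u) = field R (![t, x, y], u) := fun x y u => h ht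
  have h0 := key 0 0 0
  have h1 := key 1 0 0
  have h2 := key 0 1 0
  have h3 := key 0 0 1
  simp [field] at h0 h1 h2 h3
  obtain ⟨⟨a, b, c⟩, d⟩ := h0
  obtain ⟨⟨a1, b1⟩, d1⟩ := h1
  have e0 : P 0 = R 0 := by linarith
  have e6 : P 6 = R 6 := by rw [d] at b; linarith
  have e4 : P 4 = R 4 := by rw [d, e0] at b1; linarith
  rw [e0, e4] at h3
  have e1 : P 1 = R 1 := by linarith [h3.2]
  have e2 : P 2 = R 2 := by rw [e0, e1] at a; linarith
  have e3 : P 3 = R 3 := by linarith [h2.1]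
  funext i
  fin_cases i <;> assumption

/-- Turns a basis claim into linear algebra in the eight parameters: M sends coordinates in the
proposed basis to parameters. Its trivial kernel gives independence, and its range being the
solution set of the classifying condition gives spanning. -/
theorem isBasis_of_param (hf : InClass f I) {n : ℕ} {B : Fin n → VField}
    (M : (Fin n → ℝ) → Fin 8 → ℝ) (hB : ∀ g z, ∑ i, g i • B i z = field (M g) z)
    (hM : ∀ g, M g = 0 → g = 0)
    (hC : ∀ P : Fin 8 → ℝ, Classifying f I (P 0) (P 1) (P 2) (P 3) ↔ ∃ g, P = M g) :
    IsBasisOfMaxAlgebra f I B := by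
  have hsum : ∀ g : Fin n → ℝ, ∑ i, g i • (dom I).domRestrict (B i)
      = (dom I).domRestrict (field (M g)) := by
    intro g
    funext z
    have := hB g z
    simpa [Finset.sum_apply] using this
  have h0 : ∀ z, field 0 z = 0 := fun z => by
    refine Prod.ext (funext fun k => ?_) ?_
    · fin_cases k <;> simp [field]
    · simp [field]
  refine ⟨Fintype.linearIndependent_iff.2 fun g hg => ?_, ?_⟩
  · rw [hsum] at hg
    have : M g = 0 := field_injective hf.nonempty fun z hz => by
      rw [h0]; exact congrFun hg ⟨z, hz⟩
    exact fun i => congrFun (hM g this) i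
  · ext Q
    rw [SetLike.mem_coe, Submodule.mem_span_range_iff_exists_fun]
    constructor
    · rintro ⟨V, hV, rfl⟩
      obtain ⟨P, hP, hVP⟩ := (isLieSymmetry_iff hf).1 hV
      obtain ⟨g, rfl⟩ := (hC P).1 hP
      refine ⟨g, ?_⟩
      rw [hsum]
      funext z
      exact (hVP z.2).symm
    · rintro ⟨g, rfl⟩
      exact ⟨field (M g), (isLieSymmetry_iff hf).2 ⟨M g, (hC _).2 ⟨g, rfl⟩, fun _ _ => rfl⟩,
        hsum g⟩

theorem eq_vec8 {P : Fin 8 → ℝ} {a b c d e k l m : ℝ} (h0 : P 0 = a) (h1 : P 1 = b) (h2 : P 2 = c)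
    (h3 : P 3 = d) (h4 : P 4 = e) (h5 : P 5 = k) (h6 : P 6 = l) (h7 : P 7 = m) :
    P = ![a, b, c, d, e, k, l, m] := by
  funext i
  fin_cases i <;> assumption

theorem kernel_sum (g : Fin 4 → ℝ) (z : Pt) : ∑ i, g i • kernelBasis i z
    = field ![0, 0, 0, 0, g 2, g 3, g 0, g 1] z := by
  refine Prod.ext (funext fun k => ?_) ?_
  · fin_cases k <;>
    (simp [Fin.sum_univ_four, kernelBasis, dX, dY, scaling, galilean, field]; try ring)
  · simp [Fin.sum_univ_four, kernelBasis, dX, dY, scaling, galilean, field]; ring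

theorem classifying_zero : Classifying f I 0 0 0 0 := fun t _ => by
  simpa using hasDerivAt_const t (0 : ℝ)

theorem kernel_isBasis (hf : InClass f I)
    (h : ∀ a b c d, Classifying f I a b c d → a = 0 ∧ b = 0 ∧ c = 0 ∧ d = 0) :
    IsBasisOfMaxAlgebra f I kernelBasis := by
  refine isBasis_of_param hf (fun g => ![0, 0, 0, 0, g 2, g 3, g 0, g 1]) kernel_sum
    (fun g hg => ?_) fun P => ⟨fun hP => ?_, ?_⟩
  · funext i
    fin_cases i
    exacts [congrFun hg 6, congrFun hg 7, congrFun hg 4, congrFun hg 5]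
  · obtain ⟨h0, h1, h2, h3⟩ := h _ _ _ _ hP
    exact ⟨![P 6, P 7, P 4, P 5], eq_vec8 h0 h1 h2 h3 rfl rfl rfl rfl⟩
  · rintro ⟨g, rfl⟩
    exact classifying_zero

/-- Kernel fields have τ = 0 and η_y = 0, so a nontrivial solution (τ, c) would give a symmetry
outside their span. -/
theorem classifying_eq_zero_of_kernel (hf : InClass f I)
    (h : IsBasisOfMaxAlgebra f I kernelBasis) {a b c d : ℝ} (hc : Classifying f I a b c d) :
    a = 0 ∧ b = 0 ∧ c = 0 ∧ d = 0 := by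
  have hm : (dom I).domRestrict (field ![a, b, c, d, 0, 0, 0, 0]) ∈ maxAlgebra f I :=
    ⟨_, (isLieSymmetry_iff hf).2 ⟨_, hc, fun _ _ => rfl⟩, rfl⟩
  rw [h.2, SetLike.mem_coe, Submodule.mem_span_range_iff_exists_fun] at hm
  obtain ⟨g, hg⟩ := hm
  have := field_injective (P := ![0, 0, 0, 0, g 2, g 3, g 0, g 1])
    (R := ![a, b, c, d, 0, 0, 0, 0]) hf.nonempty fun z hz => by
    rw [← kernel_sum]
    have := congrFun hg ⟨z, hz⟩
    simpa [Finset.sum_apply] using this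
  exact ⟨(congrFun this 0).symm, (congrFun this 1).symm, (congrFun this 2).symm,
    (congrFun this 3).symm⟩

/-- For coefficients whose classifying condition has exactly a line of solutions, spanned by (a, b,
c, d). -/
theorem basis_five_of (hf : InClass f I) {E : VField} {a b c d : ℝ}
    (hE : ∀ z, E z = field ![a, b, c, d, 0, 0, 0, 0] z) (hne : ![a, b, c, d] ≠ 0)
    (h : ∀ p q r s, Classifying f I p q r s ↔ ∃ m : ℝ, p = m * a ∧ q = m * b ∧ r = m * c ∧
      s = m * d) :
    IsBasisOfMaxAlgebra f I ![dX, dY, scaling, galilean, E] := by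
  refine isBasis_of_param hf
    (fun g => ![g 4 * a, g 4 * b, g 4 * c, g 4 * d, g 2, g 3, g 0, g 1]) (fun g z => ?_)
    (fun g hg => ?_) fun P => ⟨fun hP => ?_, ?_⟩
  · refine Prod.ext (funext fun k => ?_) ?_
    · fin_cases k <;> simp [Fin.sum_univ_five, dX, dY, scaling, galilean, hE, field] <;> ring
    · simp [Fin.sum_univ_five, dX, dY, scaling, galilean, hE, field]; ring
  · have g4 : g 4 = 0 := by
      by_contra h4
      have h0 : g 4 * a = 0 := congrFun hg 0
      have h1 : g 4 * b = 0 := congrFun hg 1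
      have h2 : g 4 * c = 0 := congrFun hg 2
      have h3 : g 4 * d = 0 := congrFun hg 3
      simp only [mul_eq_zero, h4, false_or] at h0 h1 h2 h3
      apply hne
      funext i
      fin_cases i <;> assumption
    funext i
    fin_cases i
    exacts [congrFun hg 6, congrFun hg 7, congrFun hg 4, congrFun hg 5, g4]
  · obtain ⟨m, h0, h1, h2, h3⟩ := (h _ _ _ _).1 hP
    exact ⟨![P 6, P 7, P 4, P 5, m], eq_vec8 h0 h1 h2 h3 rfl rfl rfl rfl⟩
  · rintro ⟨g, rfl⟩
    exact (h _ _ _ _).2 ⟨g 4, rfl, rfl, rfl, rfl⟩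

/-! ### The canonical coefficients -/

theorem hasDerivAt_arctan_coeff (σ t : ℝ) : HasDerivAt (ExtCase.arctan σ).coeff
    ((σ - 2 * t) / (t ^ 2 + 1) * (ExtCase.arctan σ).coeff t) t := by
  have hp : t ^ 2 + 1 ≠ 0 := by positivity
  have h1 : HasDerivAt (fun t : ℝ => t ^ 2 + 1) (2 * t) t := by
    simpa using ((hasDerivAt_id t).pow 2).add_const 1
  have h2 := ((Real.hasDerivAt_arctan t).const_mul σ).exp.div h1 hp
  refine h2.congr_deriv ?_
  simp only [ExtCase.coeff]
  have : 1 + t ^ 2 = t ^ 2 + 1 := by ring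
  rw [this]
  field_simp

theorem arctan_inClass (σ : ℝ) (hI : IsOpen I) (hI' : I.OrdConnected) (hne : I.Nonempty) :
    InClass (ExtCase.arctan σ).coeff I := by
  refine ⟨hI, hI', hne, ?_, fun t _ => ?_⟩
  · have h : ContDiff ℝ ∞ (ExtCase.arctan σ).coeff := by
      refine ContDiff.div ?_ (by fun_prop) (fun t => by positivity)
      exact (contDiff_const.mul (Real.contDiff_arctan)).exp
    exact h.contDiffOn
  · have : 0 < (ExtCase.arctan σ).coeff t := by simp only [ExtCase.coeff]; positivity
    exact this.ne'

/-- Divided by f and multiplied by t² + 1, the condition is a quadratic in t. Eliminating b and d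
from its three coefficients leaves (a - c)(4 + σ²) = 0. -/
theorem arctan_classifying (σ : ℝ) (hI : IsOpen I) (hI' : I.OrdConnected) (hne : I.Nonempty)
    (a b c d : ℝ) : Classifying (ExtCase.arctan σ).coeff I a b c d ↔
      ∃ m : ℝ, a = m * 1 ∧ b = m * 0 ∧ c = m * 1 ∧ d = m * (σ / 2) := by
  have hf := arctan_inClass σ hI hI' hne
  rw [classifying_iff hf]
  simp only [(hasDerivAt_arctan_coeff σ _).deriv]
  constructor
  · intro h
    obtain ⟨-, h2, h1, h0⟩ := cubic_eq_zero hI hne (a := 0) (b := -b + σ * a - 2 * d)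
      (c := 2 * a + σ * b - 2 * c) (d := b + σ * c - 2 * d) (fun t ht => by
        have hp : t ^ 2 + 1 ≠ 0 := by positivity
        refine mul_left_cancel₀ (hf.ne_zero t ht) ?_
        have := h t ht
        field_simp at this
        linear_combination this)
    have e : (a - c) * (4 + σ ^ 2) = 0 := by linear_combination 2 * h1 + σ * h2 - σ * h0
    have e1 : a - c = 0 := (mul_eq_zero.1 e).resolve_right (by positivity)
    have ec : c = a := by linarith
    subst ec
    have eb : b = 0 := by linarith
    subst eb
    exact ⟨c, by ring, by ring, by ring, by linarith⟩
  · rintro ⟨m, rfl, rfl, rfl, rfl⟩ t ht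
    have hp : t ^ 2 + 1 ≠ 0 := by positivity
    field_simp
    ring

theorem hasDerivAt_power_coeff (ρ : ℝ) {t : ℝ} (ht : t ≠ 0) : HasDerivAt (ExtCase.power ρ).coeff
    (ρ / t * (ExtCase.power ρ).coeff t) t := by
  have h1 := (hasDerivAt_abs ht).rpow_const (p := ρ) (Or.inl (abs_ne_zero.2 ht))
  refine h1.congr_deriv ?_
  simp only [ExtCase.coeff]
  rw [Real.rpow_sub_one (abs_ne_zero.2 ht)]
  rcases ht.lt_or_gt with h | h
  · simp [abs_of_neg h, h]; field_simp
  · simp [abs_of_pos h, h]; field_simp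

theorem power_inClass (ρ : ℝ) (hI : IsOpen I) (hI' : I.OrdConnected) (hne : I.Nonempty)
    (h0 : (0 : ℝ) ∉ I) : InClass (ExtCase.power ρ).coeff I := by
  have ht0 : ∀ t ∈ I, t ≠ 0 := fun t ht h => h0 (h ▸ ht)
  refine ⟨hI, hI', hne, fun t ht => ?_, fun t ht => ?_⟩
  · exact ((contDiffAt_abs (ht0 t ht)).rpow_const_of_ne
      (abs_ne_zero.2 (ht0 t ht))).contDiffWithinAt
  · exact (Real.rpow_pos_of_pos (abs_pos.2 (ht0 t ht)) ρ).ne'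

/-- Divided by f and multiplied by t, the condition has coefficients a (2 + ρ), b (1 + ρ) - 2 d and
ρ c. The excluded exponents -2 and 0 are those for which a or c would remain free. -/
theorem power_classifying {ρ : ℝ} (hρ : ρ ≠ 0) (hρ' : ρ ≠ -2) (hI : IsOpen I)
    (hI' : I.OrdConnected) (hne : I.Nonempty) (h0 : (0 : ℝ) ∉ I)
    (a b c d : ℝ) : Classifying (ExtCase.power ρ).coeff I a b c d ↔
      ∃ m : ℝ, a = m * 0 ∧ b = m * 2 ∧ c = m * 0 ∧ d = m * (ρ + 1) := by
  have ht0 : ∀ t ∈ I, t ≠ 0 := fun t ht h => h0 (h ▸ ht)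
  have hf := power_inClass ρ hI hI' hne h0
  rw [classifying_iff hf]
  constructor
  · intro h
    obtain ⟨-, h2, h1, h0⟩ := cubic_eq_zero hI hne (a := 0) (b := a * (2 + ρ))
      (c := b * (1 + ρ) - 2 * d) (d := ρ * c) (fun t ht => by
        have hp := ht0 t ht
        refine mul_left_cancel₀ (hf.ne_zero t ht) ?_
        have := h t ht
        rw [(hasDerivAt_power_coeff ρ hp).deriv] at this
        field_simp at this
        linear_combination this)
    have ha : a = 0 := (mul_eq_zero.1 h2).resolve_right (fun h => hρ' (by linarith))
    have hc : c = 0 := (mul_eq_zero.1 h0).resolve_left hρ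
    exact ⟨b / 2, by simp [ha], by ring, by simp [hc], by linarith⟩
  · rintro ⟨m, rfl, rfl, rfl, rfl⟩ t ht
    have hp := ht0 t ht
    rw [(hasDerivAt_power_coeff ρ hp).deriv]
    field_simp
    ring

theorem exp_inClass {s : ℝ} (hs : s ≠ 0) (hI : IsOpen I) (hI' : I.OrdConnected)
    (hne : I.Nonempty) : InClass (ExtCase.exp s).coeff I := by
  refine ⟨hI, hI', hne, ?_, fun t _ => mul_ne_zero hs (Real.exp_ne_zero t)⟩
  exact (contDiff_const.mul Real.contDiff_exp).contDiffOn

theorem exp_classifying {s : ℝ} (hs : s ≠ 0) (hI : IsOpen I) (hI' : I.OrdConnected)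
    (hne : I.Nonempty) (a b c d : ℝ) : Classifying (ExtCase.exp s).coeff I a b c d ↔
      ∃ m : ℝ, a = m * 0 ∧ b = m * 0 ∧ c = m * 2 ∧ d = m * 1 := by
  have hf := exp_inClass hs hI hI' hne
  have hd : ∀ t, deriv (ExtCase.exp s).coeff t = (ExtCase.exp s).coeff t := fun t =>
    ((Real.hasDerivAt_exp t).const_mul s).deriv
  rw [classifying_iff hf]
  simp only [hd]
  constructor
  · intro h
    obtain ⟨-, h2, h1, h0⟩ := cubic_eq_zero hI hne (a := 0) (b := a)
      (c := 2 * a + b) (d := b + c - 2 * d) (fun t ht => by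
        refine mul_left_cancel₀ (hf.ne_zero t ht) ?_
        linear_combination h t ht)
    exact ⟨d, by linarith, by linarith, by linarith, by ring⟩
  · rintro ⟨m, rfl, rfl, rfl, rfl⟩ t ht
    ring

theorem const_inClass (hI : IsOpen I) (hI' : I.OrdConnected) (hne : I.Nonempty) :
    InClass ExtCase.const.coeff I :=
  ⟨hI, hI', hne, contDiffOn_const, fun _ _ => one_ne_zero⟩

theorem const_classifying (hI : IsOpen I) (hI' : I.OrdConnected) (hne : I.Nonempty)
    (a b c d : ℝ) : Classifying ExtCase.const.coeff I a b c d ↔ a = 0 ∧ b = 2 * d := by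
  have hf := const_inClass hI hI' hne
  have hd : ∀ t, deriv ExtCase.const.coeff t = 0 := fun t => (hasDerivAt_const t (1 : ℝ)).deriv
  rw [classifying_iff hf]
  simp only [hd]
  constructor
  · intro h
    obtain ⟨-, -, h1, h0⟩ := cubic_eq_zero hI hne (a := 0) (b := 0)
      (c := 2 * a) (d := b - 2 * d) (fun t ht => by
        refine mul_left_cancel₀ (hf.ne_zero t ht) ?_
        linear_combination h t ht)
    exact ⟨by linarith, by linarith⟩
  · rintro ⟨rfl, rfl⟩ t ht
    ring

theorem const_isBasis (hI : IsOpen I) (hI' : I.OrdConnected) (hne : I.Nonempty) :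
    IsBasisOfMaxAlgebra ExtCase.const.coeff I ![dX, dY, scaling, galilean, dT, extConst] := by
  refine isBasis_of_param (const_inClass hI hI' hne)
    (fun g => ![0, 2 * g 5, g 4, g 5, g 2, g 3, g 0, g 1]) (fun g z => ?_)
    (fun g hg => ?_) fun P => ?_
  · refine Prod.ext (funext fun k => ?_) ?_
    · fin_cases k <;>
      simp [Fin.sum_univ_six, dX, dY, scaling, galilean, dT, extConst, field] <;> ring
    · simp [Fin.sum_univ_six, dX, dY, scaling, galilean, dT, extConst, field]; ring
  · funext i
    fin_cases i
    exacts [congrFun hg 6, congrFun hg 7, congrFun hg 4, congrFun hg 5, congrFun hg 2,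
      congrFun hg 3]
  · rw [const_classifying hI hI' hne]
    constructor
    · rintro ⟨h0, h1⟩
      exact ⟨![P 6, P 7, P 4, P 5, P 2, P 3], eq_vec8 h0 h1 rfl rfl rfl rfl rfl rfl⟩
    · rintro ⟨g, rfl⟩
      exact ⟨rfl, rfl⟩

theorem expSq_inClass (hI : IsOpen I) (hI' : I.OrdConnected) (hne : I.Nonempty) :
    InClass (fun t => Real.exp (t ^ 2)) I :=
  ⟨hI, hI', hne, by fun_prop, fun _ _ => Real.exp_ne_zero _⟩

/-- Here f'/f = 2 t, so the condition is a cubic in t whose four coefficients annihilate a, b, c, d.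
This f witnesses that the kernel can be the whole algebra. -/
theorem expSq_classifying (hI : IsOpen I) (hI' : I.OrdConnected) (hne : I.Nonempty)
    (a b c d : ℝ) (h : Classifying (fun t => Real.exp (t ^ 2)) I a b c d) :
    a = 0 ∧ b = 0 ∧ c = 0 ∧ d = 0 := by
  have hf := expSq_inClass hI hI' hne
  have hd : ∀ t, deriv (fun t : ℝ => Real.exp (t ^ 2)) t = Real.exp (t ^ 2) * (2 * t) := fun t => by
    simp
  rw [classifying_iff hf] at h
  simp only [hd] at h
  obtain ⟨h3, h2, h1, h0⟩ := cubic_eq_zero hI hne (a := 2 * a) (b := 2 * b)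
    (c := 2 * a + 2 * c) (d := b - 2 * d) (fun t ht => by
      refine mul_left_cancel₀ (Real.exp_ne_zero (t ^ 2)) ?_
      linear_combination h t ht)
  refine ⟨?_, ?_, ?_, ?_⟩ <;> linarith

/-- A common symmetry is in particular one for exp(t²), whose algebra is just the kernel.
Conversely, kernel fields have τ = 0 and c = 0, which satisfies the classifying condition for every
f. -/
theorem kernel_common (hI : IsOpen I) (hI' : I.OrdConnected) (hne : I.Nonempty) (V : VField) :
    (∀ f : ℝ → ℝ, InClass f I → IsLieSymmetry f I V) ↔
      (dom I).domRestrict V ∈ Submodule.span ℝ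
        (Set.range fun i => (dom I).domRestrict (kernelBasis i)) := by
  have hb := kernel_isBasis (expSq_inClass hI hI' hne) (expSq_classifying hI hI' hne)
  constructor
  · intro h
    rw [← SetLike.mem_coe, ← hb.2]
    exact ⟨V, h _ (expSq_inClass hI hI' hne), rfl⟩
  · intro h f hf
    rw [Submodule.mem_span_range_iff_exists_fun] at h
    obtain ⟨g, hg⟩ := h
    refine (isLieSymmetry_iff hf).2 ⟨![0, 0, 0, 0, g 2, g 3, g 0, g 1], classifying_zero,
      fun z hz => ?_⟩
    rw [← kernel_sum]
    have := congrFun hg ⟨z, hz⟩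
    simpa [Finset.sum_apply] using this.symm

end Kolmogorov

namespace Kolmogorov

variable {I I' I'' : Set ℝ} {f f' f'' : ℝ → ℝ} {α β γ δ k : ℝ}

/-! ### Fractional linear transformations of the coefficients -/

/-- The action of the equivalence group on coefficients: `t ↦ (α t + β) / (γ t + δ)` is defined
on `I` and maps `f` on `I` to `f'` on `I'`, with `k = λ²`. -/
structure MobiusCarries (α β γ δ k : ℝ) (f : ℝ → ℝ) (I : Set ℝ) (f' : ℝ → ℝ) (I' : Set ℝ) :
    Prop where
  det_ne : α * δ - β * γ ≠ 0
  pos : 0 < k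
  ne : ∀ t ∈ I, γ * t + δ ≠ 0
  image_eq : (fun t => (α * t + β) / (γ * t + δ)) '' I = I'
  coeff_eq : ∀ t ∈ I, f' ((α * t + β) / (γ * t + δ)) =
    k / (α * δ - β * γ) * (γ * t + δ) ^ 2 * f t

theorem EquivTransf.mem_dom_image {g : EquivTransf} (h : ∀ t ∈ I, g.γ * t + g.δ ≠ 0) (z : Pt) :
    z ∈ g.pointMap '' dom I ↔ z.1 0 ∈ (fun t => (g.α * t + g.β) / (g.γ * t + g.δ)) '' I := by
  constructor
  · rintro ⟨z, hz, rfl⟩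
    exact ⟨z.1 0, hz, rfl⟩
  · rintro ⟨t, ht, e⟩
    have hD := h t ht
    have hΔ := g.det_ne
    have hκ := g.κ_ne
    have hl := g.lam_ne
    refine ⟨(![t, ((g.γ * t + g.δ) * z.1 1 - g.μ * t - g.ν) / g.κ, (z.1 2 - g.ε) / g.lam],
      (g.det * z.2 + g.κ * g.γ * (((g.γ * t + g.δ) * z.1 1 - g.μ * t - g.ν) / g.κ)
        - g.δ * g.μ + g.γ * g.ν) / (g.κ * (g.γ * t + g.δ))), ht, ?_⟩
    refine Prod.ext (funext fun i => ?_) ?_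
    · fin_cases i
      · exact e
      · simp [pointMap]; field_simp; ring
      · simp [pointMap]; field_simp; ring
    · have hd : g.det ≠ 0 := hΔ
      simp [pointMap]; field_simp; ring

theorem EquivTransf.Carries.mobius {g : EquivTransf} (h : g.Carries f I f' I') :
    MobiusCarries g.α g.β g.γ g.δ (g.lam ^ 2) f I f' I' := by
  refine ⟨g.det_ne, by have := g.lam_ne; positivity, h.1, ?_, fun t ht => ?_⟩
  · ext s
    have := g.mem_dom_image h.1 (![s, 0, 0], 0)
    rw [h.2.1] at this
    exact this.symm
  · exact h.2.2 (![t, 0, 0], 0) ht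

/-- κ, μ, ν and ε act neither on t nor on f, so equivalence depends only on the Möbius map and k =
λ². For the converse they are set to κ = 1, μ = ν = ε = 0, with λ = √k. -/
theorem equivalent_iff : Equivalent f I f' I' ↔ ∃ α β γ δ k, MobiusCarries α β γ δ k f I f' I' := by
  constructor
  · rintro ⟨g, hg⟩
    exact ⟨_, _, _, _, _, hg.mobius⟩
  · rintro ⟨α, β, γ, δ, k, h⟩
    refine ⟨⟨α, β, γ, δ, 1, 0, 0, √k, 0, h.det_ne, one_ne_zero, (Real.sqrt_pos.2 h.pos).ne'⟩,
      h.ne, ?_, fun z hz => ?_⟩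
    · ext z
      rw [EquivTransf.mem_dom_image h.ne, h.image_eq]
      rfl
    · have := h.coeff_eq _ hz
      simpa [EquivTransf.pointMap, EquivTransf.det, Real.sq_sqrt h.pos.le] using this

theorem mobius_left_inv (hd : α * δ - β * γ ≠ 0) {t : ℝ} (h1 : γ * t + δ ≠ 0) :
    (δ * ((α * t + β) / (γ * t + δ)) + -β) / (-γ * ((α * t + β) / (γ * t + δ)) + α) = t := by
  have e : -γ * ((α * t + β) / (γ * t + δ)) + α = (α * δ - β * γ) / (γ * t + δ) := by
    field_simp
    ring
  rw [e, div_eq_iff (div_ne_zero hd h1), mul_div_assoc', mul_div_assoc', eq_div_iff h1, add_mul,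
    div_mul_cancel₀ _ h1]
  ring

namespace MobiusCarries

theorem mem (h : MobiusCarries α β γ δ k f I f' I') {t : ℝ} (ht : t ∈ I) :
    (α * t + β) / (γ * t + δ) ∈ I' := h.image_eq ▸ ⟨t, ht, rfl⟩

theorem exists_eq (h : MobiusCarries α β γ δ k f I f' I') {s : ℝ} (hs : s ∈ I') :
    ∃ t ∈ I, (α * t + β) / (γ * t + δ) = s := by
  rw [← h.image_eq] at hs; exact hs

theorem inv_denom (h : MobiusCarries α β γ δ k f I f' I') {t : ℝ} (ht : t ∈ I) :
    -γ * ((α * t + β) / (γ * t + δ)) + α = (α * δ - β * γ) / (γ * t + δ) := by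
  have := h.ne t ht
  field_simp
  ring

theorem left_inv (h : MobiusCarries α β γ δ k f I f' I') {t : ℝ} (ht : t ∈ I) :
    (δ * ((α * t + β) / (γ * t + δ)) + -β) / (-γ * ((α * t + β) / (γ * t + δ)) + α) = t :=
  mobius_left_inv h.det_ne (h.ne t ht)

/-- The adjugate matrix represents the inverse and has the same determinant Δ. Its denominator at
the image point is Δ / (γ t + δ), which makes the factors cancel once k is inverted. -/
theorem symm (h : MobiusCarries α β γ δ k f I f' I') :
    MobiusCarries δ (-β) (-γ) α k⁻¹ f' I' f I := by
  have e : δ * α - -β * -γ = α * δ - β * γ := by ring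
  refine ⟨by rw [e]; exact h.det_ne, inv_pos.2 h.pos, fun s hs => ?_, ?_, fun s hs => ?_⟩
  · obtain ⟨t, ht, rfl⟩ := h.exists_eq hs
    rw [h.inv_denom ht]
    exact div_ne_zero h.det_ne (h.ne t ht)
  · ext t
    constructor
    · rintro ⟨s, hs, rfl⟩
      obtain ⟨t, ht, rfl⟩ := h.exists_eq hs
      simpa only [h.left_inv ht] using ht
    · intro ht
      exact ⟨_, h.mem ht, h.left_inv ht⟩
  · obtain ⟨t, ht, rfl⟩ := h.exists_eq hs
    rw [h.left_inv ht, h.coeff_eq t ht, h.inv_denom ht, e]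
    have h1 := h.ne t ht
    have h2 := h.det_ne
    have h3 := h.pos.ne'
    field_simp

/-- The matrices multiply, and the denominators γ t + δ satisfy the cocycle identity `hD`. -/
theorem trans {α' β' γ' δ' k' : ℝ} (h : MobiusCarries α β γ δ k f I f' I')
    (h' : MobiusCarries α' β' γ' δ' k' f' I' f'' I'') :
    MobiusCarries (α' * α + β' * γ) (α' * β + β' * δ) (γ' * α + δ' * γ) (γ' * β + δ' * δ)
      (k' * k) f I f'' I'' := by
  have e : (α' * α + β' * γ) * (γ' * β + δ' * δ) - (α' * β + β' * δ) * (γ' * α + δ' * γ)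
    = (α' * δ' - β' * γ') * (α * δ - β * γ) := by ring
  have hD : ∀ t ∈ I, (γ' * α + δ' * γ) * t + (γ' * β + δ' * δ)
      = (γ' * ((α * t + β) / (γ * t + δ)) + δ') * (γ * t + δ) := fun t ht => by
    have := h.ne t ht
    field_simp
    ring
  have hφ : ∀ t ∈ I, ((α' * α + β' * γ) * t + (α' * β + β' * δ)) /
      ((γ' * α + δ' * γ) * t + (γ' * β + δ' * δ)) = (α' * ((α * t + β) / (γ * t + δ)) + β') /
        (γ' * ((α * t + β) / (γ * t + δ)) + δ') := fun t ht => by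
    have h1 := h.ne t ht
    have h2 := h'.ne _ (h.mem ht)
    rw [hD t ht, div_eq_div_iff (mul_ne_zero h2 h1) h2]
    field_simp
    ring
  refine ⟨by rw [e]; exact mul_ne_zero h'.det_ne h.det_ne, mul_pos h'.pos h.pos, fun t ht => ?_,
    ?_, fun t ht => ?_⟩
  · rw [hD t ht]
    exact mul_ne_zero (h'.ne _ (h.mem ht)) (h.ne t ht)
  · rw [Set.image_congr hφ, ← h'.image_eq, ← h.image_eq, Set.image_image]
  · rw [hφ t ht, h'.coeff_eq _ (h.mem ht), h.coeff_eq t ht, hD t ht, e]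
    have h1 := h.det_ne
    have h2 := h'.det_ne
    field_simp

theorem hasDerivAt (h : MobiusCarries α β γ δ k f I f' I') {t : ℝ} (ht : t ∈ I) :
    HasDerivAt (fun t => (α * t + β) / (γ * t + δ)) ((α * δ - β * γ) / (γ * t + δ) ^ 2) t := by
  have h1 : ∀ a b : ℝ, HasDerivAt (fun t : ℝ => a * t + b) a t := fun a b => by
    simpa using ((hasDerivAt_id t).const_mul a).add_const b
  refine ((h1 α β).div (h1 γ δ) (h.ne t ht)).congr_deriv ?_
  ring

theorem contDiffOn (h : MobiusCarries α β γ δ k f I f' I') :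
    ContDiffOn ℝ ∞ (fun t => (α * t + β) / (γ * t + δ)) I :=
  ContDiffOn.div (by fun_prop) (by fun_prop) h.ne

/-- I' is the preimage of I under the inverse Möbius map, which is continuous off its pole. -/
theorem isOpen (h : MobiusCarries α β γ δ k f I f' I') (hI : IsOpen I) : IsOpen I' := by
  have e : I' = {s | -γ * s + α ≠ 0} ∩ (fun s => (δ * s + -β) / (-γ * s + α)) ⁻¹' I := by
    ext s
    constructor
    · intro hs
      obtain ⟨t, ht, rfl⟩ := h.exists_eq hs
      exact ⟨h.symm.ne _ hs, by simpa only [Set.mem_preimage, h.left_inv ht] using ht⟩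
    · rintro ⟨h1, h2⟩
      have h1 : -γ * s + α ≠ 0 := h1
      have := h.mem h2
      have h3 : δ * α - -β * -γ ≠ 0 := by
        have := h.det_ne
        rwa [show δ * α - -β * -γ = α * δ - β * γ by ring]
      have h4 := mobius_left_inv h3 h1
      simp only [neg_neg] at h4
      rwa [h4] at this
  rw [e]
  have ho : IsOpen {s : ℝ | -γ * s + α ≠ 0} :=
    isOpen_ne.preimage (f := fun s : ℝ => -γ * s + α) (by fun_prop)
  exact ContinuousOn.isOpen_inter_preimage
    (ContinuousOn.div (by fun_prop) (by fun_prop) fun s hs => hs) ho hI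

theorem inClass (h : MobiusCarries α β γ δ k f I f' I') (hf : InClass f I) : InClass f' I' := by
  refine ⟨h.isOpen hf.isOpen, ?_, ?_, ?_, fun s hs => ?_⟩
  · rw [← h.image_eq]
    exact (hf.ordConnected.isPreconnected.image _ h.contDiffOn.continuousOn).ordConnected
  · rw [← h.image_eq]
    exact hf.nonempty.image _
  · have h1 : ContDiffOn ℝ ∞ (fun t => k / (α * δ - β * γ) * (γ * t + δ) ^ 2 * f t) I :=
      ContDiffOn.mul (by fun_prop) hf.smooth
    have h2 := h1.comp h.symm.contDiffOn fun s hs => h.symm.mem hs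
    refine h2.congr fun s hs => ?_
    obtain ⟨t, ht, rfl⟩ := h.exists_eq hs
    simp only [Function.comp, h.left_inv ht]
    exact h.coeff_eq t ht
  · obtain ⟨t, ht, rfl⟩ := h.exists_eq hs
    rw [h.coeff_eq t ht]
    exact mul_ne_zero (mul_ne_zero (div_ne_zero h.pos.ne' h.det_ne) (pow_ne_zero _ (h.ne t ht)))
      (hf.ne_zero t ht)

/-- The pushed-forward vector field has coefficient τ Δ / (γ t + δ)², while f is multiplied by (k /
Δ)(γ t + δ)², so τ̃ f̃ = k τ f at corresponding points. Differentiating in t̃ brings in dt/dt̃ = (γ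
t + δ)² / Δ, which turns k · 2 d f into 2 d f̃; hence d is unchanged. The new coefficients are those
of τ as a binary quadratic form after the substitution, divided by Δ. -/
theorem classifying (h : MobiusCarries α β γ δ k f I f' I') (hI : IsOpen I) {a b c d : ℝ}
    (hc : Classifying f I a b c d) : Classifying f' I'
      ((a * δ ^ 2 - b * δ * γ + c * γ ^ 2) / (α * δ - β * γ))
      ((-2 * a * β * δ + b * (α * δ + β * γ) - 2 * c * α * γ) / (α * δ - β * γ))
      ((a * β ^ 2 - b * α * β + c * α ^ 2) / (α * δ - β * γ)) d := by
  intro s hs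
  obtain ⟨t, ht, rfl⟩ := h.exists_eq hs
  have h1 : HasDerivAt (fun t => k * ((a * t ^ 2 + b * t + c) * f t)) (k * (2 * d * f t)) t :=
    (hc t ht).const_mul k
  have h2 := h.symm.hasDerivAt hs
  rw [← h.left_inv ht] at h1
  have h3 := HasDerivAt.comp (h := fun s => (δ * s + -β) / (-γ * s + α))
    (h₂ := fun t => k * ((a * t ^ 2 + b * t + c) * f t)) _ h1 h2
  refine (h3.congr_of_eventuallyEq ?_).congr_deriv ?_
  · filter_upwards [(h.isOpen hI).mem_nhds hs] with s hs
    obtain ⟨t, ht, rfl⟩ := h.exists_eq hs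
    simp only [Function.comp, h.left_inv ht, h.coeff_eq t ht]
    have h1 := h.det_ne
    have h2 := h.ne t ht
    have key : (a * δ ^ 2 - b * δ * γ + c * γ ^ 2) * (α * t + β) ^ 2
        + (-2 * a * β * δ + b * (α * δ + β * γ) - 2 * c * α * γ) * (α * t + β) * (γ * t + δ)
        + (a * β ^ 2 - b * α * β + c * α ^ 2) * (γ * t + δ) ^ 2
        = (α * δ - β * γ) ^ 2 * (a * t ^ 2 + b * t + c) := by ring
    generalize α * δ - β * γ = e at *
    generalize γ * t + δ = D at *
    generalize α * t + β = N at *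
    field_simp
    linear_combination k * f t * key
  · rw [h.left_inv ht, h.inv_denom ht, h.coeff_eq t ht]
    have h1 := h.det_ne
    have h2 := h.ne t ht
    have e : δ * α - -β * -γ = α * δ - β * γ := by ring
    rw [e]
    field_simp

end MobiusCarries

/-- Every admissible fractional linear transformation can be applied to a coefficient. -/
theorem exists_mobiusCarries (f : ℝ → ℝ) {α β γ δ : ℝ} (hd : α * δ - β * γ ≠ 0)
    (hI : ∀ t ∈ I, γ * t + δ ≠ 0) : ∃ f' I', MobiusCarries α β γ δ 1 f I f' I' := by
  refine ⟨fun s => 1 / (α * δ - β * γ) * (γ * ((δ * s + -β) / (-γ * s + α)) + δ) ^ 2 *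
    f ((δ * s + -β) / (-γ * s + α)), _, hd, one_pos, hI, rfl, fun t ht => ?_⟩
  simp only [mobius_left_inv hd (hI t ht)]

end Kolmogorov

namespace Kolmogorov

variable {I I' I'' : Set ℝ} {f f' f'' : ℝ → ℝ} {α β γ δ k : ℝ}

/-! ### Completeness of the classification -/

/-- For t̃ = -1/t one has Δ = 1 and f̃ = t² |t|^ρ = |t̃|^(-2-ρ). -/
theorem power_mobiusCarries (ρ : ℝ) (h0 : (0 : ℝ) ∉ I) :
    MobiusCarries 0 (-1) 1 0 1 (ExtCase.power ρ).coeff I (ExtCase.power (-2 - ρ)).coeff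
      ((fun t : ℝ => -1 / t) '' I) := by
  have ht0 : ∀ t ∈ I, t ≠ 0 := fun t ht h => h0 (h ▸ ht)
  refine ⟨by norm_num, one_pos, fun t ht => by simpa using ht0 t ht, by simp, fun t ht => ?_⟩
  have hp : 0 < |t| := abs_pos.2 (ht0 t ht)
  have e : |(0 * t + -1) / (1 * t + 0)| = |t|⁻¹ := by simp [abs_div]
  simp only [ExtCase.coeff, e]
  rw [Real.inv_rpow hp.le, ← Real.rpow_neg hp.le, show -(-2 - ρ) = ((2 : ℕ) : ℝ) + ρ by simp; ring,
    Real.rpow_add hp, Real.rpow_natCast, sq_abs]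
  norm_num

/-- `f` is equivalent to one of the canonical coefficients. -/
def HasCanonical (f : ℝ → ℝ) (I : Set ℝ) : Prop :=
  ∃ (c : ExtCase) (I' : Set ℝ), c.Canonical I' ∧ Equivalent f I c.coeff I'

theorem HasCanonical.of_mobius (h : MobiusCarries α β γ δ k f I f' I')
    (h' : HasCanonical f' I') : HasCanonical f I := by
  obtain ⟨c, J, hc, hJ⟩ := h'
  obtain ⟨_, _, _, _, _, hm⟩ := equivalent_iff.1 hJ
  exact ⟨c, J, hc, equivalent_iff.2 ⟨_, _, _, _, _, h.trans hm⟩⟩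

theorem HasCanonical.mk {c : ExtCase} (h : MobiusCarries α β γ δ k f I c.coeff I')
    (hc : c.Canonical I') : HasCanonical f I :=
  ⟨c, I', hc, equivalent_iff.2 ⟨_, _, _, _, _, h⟩⟩

/-- Two solutions of a linear homogeneous first-order equation are proportional. -/
theorem exists_eq_mul (hI : IsOpen I) (hI' : I.OrdConnected) (hne : I.Nonempty) {p h : ℝ → ℝ}
    (hf : ∀ t ∈ I, HasDerivAt f (h t * f t) t) (hp : ∀ t ∈ I, HasDerivAt p (h t * p t) t)
    (hf0 : ∀ t ∈ I, f t ≠ 0) (hp0 : ∀ t ∈ I, p t ≠ 0) :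
    ∃ C, C ≠ 0 ∧ ∀ t ∈ I, f t = C * p t := by
  have hd : ∀ t ∈ I, HasDerivAt (fun t => f t / p t) 0 t := fun t ht => by
    refine ((hf t ht).div (hp t ht) (hp0 t ht)).congr_deriv ?_
    field_simp
    ring
  obtain ⟨C, hC⟩ := hI.exists_is_const_of_deriv_eq_zero hI'.isPreconnected
    (fun t ht => (hd t ht).differentiableAt.differentiableWithinAt) fun t ht => (hd t ht).deriv
  have he : ∀ t ∈ I, f t = C * p t := fun t ht => by
    rw [← hC t ht, div_mul_cancel₀ _ (hp0 t ht)]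
  obtain ⟨t, ht⟩ := hne
  refine ⟨C, fun h => hf0 t ht ?_, he⟩
  rw [he t ht, h, zero_mul]

theorem Classifying.smul {a b c d : ℝ} (h : Classifying f I a b c d) (m : ℝ) :
    Classifying f I (m * a) (m * b) (m * c) (m * d) := fun t ht => by
  refine (((h t ht).const_mul m).congr_of_eventuallyEq (.of_forall fun s => ?_)).congr_deriv ?_
  · simp; ring
  · ring

/-- For τ = 1 the condition is f' = 2 d f, so f = C exp(2 d t). Scaling t by C (if d = 0) or by 2 d
(if d ≠ 0) normalizes f. -/
theorem hasCanonical_of_exp (hf : InClass f I) {d : ℝ} (h : Classifying f I 0 0 1 d) :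
    HasCanonical f I := by
  rw [classifying_iff hf] at h
  have hp : ∀ t, HasDerivAt (fun t => Real.exp (2 * d * t)) (2 * d * Real.exp (2 * d * t)) t :=
    fun t => by
      refine (((hasDerivAt_id t).const_mul (2 * d)).exp).congr_deriv ?_
      simp; ring
  obtain ⟨C, hC, he⟩ := exists_eq_mul (h := fun _ => 2 * d) hf.isOpen hf.ordConnected hf.nonempty
    (fun t ht => (hf.hasDerivAt ht).congr_deriv (by linear_combination h t ht))
    (fun t _ => hp t) hf.ne_zero (fun _ _ => Real.exp_ne_zero _)
  by_cases hd : d = 0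
  · subst hd
    refine HasCanonical.mk (c := .const) (α := C) (β := 0) (γ := 0) (δ := 1) (k := 1)
      ⟨by simpa using hC, one_pos, by simp, rfl, fun t ht => ?_⟩ trivial
    rw [he t ht]
    simp [ExtCase.coeff, hC]
  · have hs : ∃ s : ℝ, (s = 1 ∨ s = -1) ∧ 0 < s * (2 * d / C) := by
      rcases lt_or_gt_of_ne (show 2 * d / C ≠ 0 by positivity) with h | h
      · exact ⟨-1, Or.inr rfl, by linarith⟩
      · exact ⟨1, Or.inl rfl, by linarith⟩
    obtain ⟨s, hs, hk⟩ := hs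
    refine HasCanonical.mk (c := .exp s) (α := 2 * d) (β := 0) (γ := 0) (δ := 1)
      ⟨by simpa using hd, hk, by simp, rfl, fun t ht => ?_⟩ hs
    rw [he t ht]
    simp [ExtCase.coeff]
    field_simp

/-- Inversion exchanges ρ and -2 - ρ, so the exponent can be taken at most -1; the exponents 0 and
-2 both lead to the constant coefficient. -/
theorem hasCanonical_power (ρ : ℝ) (h0 : (0 : ℝ) ∉ I) :
    HasCanonical (ExtCase.power ρ).coeff I := by
  have ht0 : ∀ t ∈ I, t ≠ 0 := fun t ht h => h0 (h ▸ ht)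
  have hid : ∀ (f f' : ℝ → ℝ) (I : Set ℝ), (∀ t, f t = f' t) →
      MobiusCarries 1 0 0 1 1 f I f' I := fun f f' I h =>
    ⟨by norm_num, one_pos, by simp, by simp, fun t _ => by simp [h]⟩
  have hzero : ∀ J : Set ℝ, HasCanonical (ExtCase.power 0).coeff J := fun J =>
    .mk (c := .const) (hid _ _ J fun t => by simp [ExtCase.coeff]) trivial
  by_cases h2 : ρ = -2
  · subst h2
    have := power_mobiusCarries (-2) h0
    norm_num at this
    exact .of_mobius this (hzero _)
  by_cases h1 : ρ ≤ -1
  · exact .mk (c := .power ρ) (hid _ _ I fun _ => rfl) ⟨h1, h2, h0⟩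
  by_cases h3 : ρ = 0
  · subst h3
    exact hzero _
  · refine .mk (c := .power (-2 - ρ)) (power_mobiusCarries ρ h0) ⟨by linarith, fun h => h3 ?_, ?_⟩
    · linarith
    · rintro ⟨t, ht, e⟩
      have := ht0 t ht
      field_simp at e
      norm_num at e

/-- Here f = C |t|^(2d - 1). The scaling t̃ = C t has Δ = C and removes C together with its sign; k
= |C|^(2d - 1) corrects the power. This is why no -|t|^ρ occurs in the list. -/
theorem hasCanonical_of_linear_zero (hf : InClass f I) (h0 : (0 : ℝ) ∉ I) {d : ℝ}
    (h : Classifying f I 0 1 0 d) : HasCanonical f I := by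
  have ht0 : ∀ t ∈ I, t ≠ 0 := fun t ht h => h0 (h ▸ ht)
  rw [classifying_iff hf] at h
  have hp := power_inClass (2 * d - 1) hf.isOpen hf.ordConnected hf.nonempty h0
  obtain ⟨C, hC, he⟩ := exists_eq_mul (h := fun t => (2 * d - 1) / t) hf.isOpen hf.ordConnected
    hf.nonempty
    (fun t ht => (hf.hasDerivAt ht).congr_deriv (by
      have := ht0 t ht
      field_simp
      linear_combination h t ht))
    (fun t ht => hasDerivAt_power_coeff (2 * d - 1) (ht0 t ht)) hf.ne_zero hp.ne_zero
  refine .of_mobius (α := C) (β := 0) (γ := 0) (δ := 1) (k := |C| ^ (2 * d - 1))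
    (f' := (ExtCase.power (2 * d - 1)).coeff) ⟨by simpa using hC,
      Real.rpow_pos_of_pos (abs_pos.2 hC) _, by simp, rfl, fun t ht => ?_⟩
    (hasCanonical_power _ ?_)
  · rw [he t ht]
    simp [ExtCase.coeff, abs_mul, Real.mul_rpow (abs_nonneg C) (abs_nonneg t)]
    field_simp
  · rintro ⟨t, ht, e⟩
    simp [hC, ht0 t ht] at e

/-- If the root r of τ lies in I, the condition at r gives 2 d = 1. Then (t - r) f' = 0, and
continuity of f' at r makes f constant. Otherwise a translation puts the root at 0, outside the
interval. -/
theorem hasCanonical_of_linear (hf : InClass f I) {r d : ℝ}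
    (h : Classifying f I 0 1 (-r) d) : HasCanonical f I := by
  by_cases hr : r ∈ I
  · rw [classifying_iff hf] at h
    have hd : 2 * d = 1 := by
      have := h r hr
      exact mul_right_cancel₀ (hf.ne_zero r hr) (by linear_combination -this)
    have h' : ∀ t ∈ I, t ≠ r → deriv f t = 0 := fun t ht htr => by
      have := h t ht
      rw [hd] at this
      have : (t - r) * deriv f t = 0 := by linear_combination this
      exact (mul_eq_zero.1 this).resolve_left (sub_ne_zero.2 htr)
    have hcont : ContinuousAt (deriv f) r :=
      (hf.smooth.continuousOn_deriv_of_isOpen hf.isOpen (by simp)).continuousAt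
        (hf.isOpen.mem_nhds hr)
    have hr0 : deriv f r = 0 := by
      refine tendsto_nhds_unique (hcont.tendsto.mono_left nhdsWithin_le_nhds : Filter.Tendsto
        (deriv f) (nhdsWithin r {r}ᶜ) _) (tendsto_const_nhds.congr' ?_)
      filter_upwards [self_mem_nhdsWithin, nhdsWithin_le_nhds (hf.isOpen.mem_nhds hr)] with t h1 h2
      exact (h' t h2 h1).symm
    refine hasCanonical_of_exp hf (d := 0) ((classifying_iff hf).2 fun t ht => ?_)
    by_cases htr : t = r
    · subst htr
      simp [hr0]
    · simp [h' t ht htr]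
  · obtain ⟨f', I', hm⟩ := exists_mobiusCarries (α := 1) (β := -r) (γ := 0) (δ := 1) f
      (by norm_num) (I := I) (by simp)
    have hc := hm.classifying hf.isOpen h
    norm_num at hc
    refine .of_mobius hm (hasCanonical_of_linear_zero (hm.inClass hf) (fun h0 => ?_) hc)
    obtain ⟨t, ht, e⟩ := hm.exists_eq h0
    simp at e
    exact hr ((show t = r by linarith) ▸ ht)

theorem hasCanonical_of_degenerate (hf : InClass f I) {b c d : ℝ} (hne : b ≠ 0 ∨ c ≠ 0)
    (h : Classifying f I 0 b c d) : HasCanonical f I := by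
  by_cases hb : b = 0
  · have hc : c ≠ 0 := hne.resolve_left (not_not.2 hb)
    have := h.smul c⁻¹
    rw [hb, mul_zero, inv_mul_cancel₀ hc] at this
    exact hasCanonical_of_exp hf this
  · have := h.smul b⁻¹
    rw [mul_zero, inv_mul_cancel₀ hb] at this
    exact hasCanonical_of_linear hf (r := -(b⁻¹ * c)) (by simpa using this)

/-- The map t̃ = -1/(t - r) sends the root to infinity, which lowers the degree of τ; the new
constant term is a. -/
theorem hasCanonical_of_root (hf : InClass f I) {a b c d r : ℝ} (ha : a ≠ 0)
    (hr : a * r ^ 2 + b * r + c = 0) (hrI : r ∉ I) (h : Classifying f I a b c d) :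
    HasCanonical f I := by
  obtain ⟨f', I', hm⟩ := exists_mobiusCarries (α := 0) (β := -1) (γ := 1) (δ := -r) f
    (by norm_num) (I := I) (fun t ht e => hrI ((show t = r by linarith) ▸ ht))
  have hc := hm.classifying hf.isOpen h
  rw [show (a * (-r) ^ 2 - b * (-r) * 1 + c * 1 ^ 2) / (0 * (-r) - -1 * 1) = 0 by
    rw [div_eq_zero_iff]; left; linear_combination hr] at hc
  refine .of_mobius hm (hasCanonical_of_degenerate (hm.inClass hf) (Or.inr ?_) hc)
  simpa using ha

/-- Here f = C exp(2 d arctan t) / (t² + 1). Since k > 0 absorbs only |C|, a negative C is handled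
by t̃ = -t, which has Δ = -1 and changes the sign of σ. -/
theorem hasCanonical_of_elliptic_normal (hf : InClass f I) {d : ℝ} (h : Classifying f I 1 0 1 d) :
    HasCanonical f I := by
  rw [classifying_iff hf] at h
  have hp := arctan_inClass (2 * d) hf.isOpen hf.ordConnected hf.nonempty
  obtain ⟨C, hC, he⟩ := exists_eq_mul (h := fun t => (2 * d - 2 * t) / (t ^ 2 + 1)) hf.isOpen
    hf.ordConnected hf.nonempty
    (fun t ht => (hf.hasDerivAt ht).congr_deriv (by
      have : t ^ 2 + 1 ≠ 0 := by positivity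
      field_simp
      linear_combination h t ht))
    (fun t _ => hasDerivAt_arctan_coeff (2 * d) t) hf.ne_zero hp.ne_zero
  rcases hC.lt_or_gt with hC' | hC'
  · refine .mk (c := .arctan (-(2 * d))) (α := -1) (β := 0) (γ := 0) (δ := 1) (k := -C⁻¹)
      ⟨by norm_num, by simpa using hC', by simp, rfl, fun t ht => ?_⟩ trivial
    rw [he t ht]
    simp [ExtCase.coeff]
    field_simp
  · refine .mk (c := .arctan (2 * d)) (α := 1) (β := 0) (γ := 0) (δ := 1) (k := C⁻¹)
      ⟨by norm_num, by simpa using hC', by simp, rfl, fun t ht => ?_⟩ trivial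
    rw [he t ht]
    simp [ExtCase.coeff]
    field_simp

/-- Completing the square, τ = a ((t + b/(2a))² + q²). The new variable t̃ = (t + b/(2a)) / q gives
τ̃ = a q (t̃² + 1), which is then divided by a q. -/
theorem hasCanonical_of_elliptic (hf : InClass f I) {a b c d : ℝ}
    (hdisc : b ^ 2 - 4 * a * c < 0) (h : Classifying f I a b c d) : HasCanonical f I := by
  have ha : a ≠ 0 := by
    rintro rfl
    nlinarith [sq_nonneg b]
  obtain ⟨q, hq, hq2⟩ : ∃ q : ℝ, 0 < q ∧ q ^ 2 = (4 * a * c - b ^ 2) / (4 * a ^ 2) := by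
    have : 0 < (4 * a * c - b ^ 2) / (4 * a ^ 2) := div_pos (by linarith) (by positivity)
    exact ⟨√_, Real.sqrt_pos.2 this, Real.sq_sqrt this.le⟩
  obtain ⟨f', I', hm⟩ := exists_mobiusCarries (α := 1) (β := b / (2 * a)) (γ := 0) (δ := q) f
    (by simpa using hq.ne') (I := I) (fun t _ => by simpa using hq.ne')
  have hc := (hm.classifying hf.isOpen h).smul (a * q)⁻¹
  rw [eq_div_iff (by positivity)] at hq2
  have e1 : (a * q)⁻¹ * ((a * q ^ 2 - b * q * 0 + c * 0 ^ 2) / (1 * q - b / (2 * a) * 0)) = 1 := by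
    field_simp
    ring
  have e2 : (a * q)⁻¹ * ((-2 * a * (b / (2 * a)) * q + b * (1 * q + b / (2 * a) * 0) - 2 * c * 1 * 0)
      / (1 * q - b / (2 * a) * 0)) = 0 := by
    field_simp
    ring
  have e3 : (a * q)⁻¹ * ((a * (b / (2 * a)) ^ 2 - b * 1 * (b / (2 * a)) + c * 1 ^ 2)
      / (1 * q - b / (2 * a) * 0)) = 1 := by
    field_simp
    linear_combination -hq2
  rw [e1, e2, e3] at hc
  exact .of_mobius hm (hasCanonical_of_elliptic_normal (hm.inClass hf) hc)

/-- A root outside I can be sent to infinity. If both roots are in I, the condition there reads τ' =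
2 d with τ' = s and τ' = -s, so s = d = 0. Then τ f is constant and vanishes at the root, hence τ =
0 on I, a contradiction; a double root is covered as well. -/
theorem hasCanonical_of_split (hf : InClass f I) {a b c d : ℝ} (ha : a ≠ 0)
    (hdisc : 0 ≤ b ^ 2 - 4 * a * c) (h : Classifying f I a b c d) : HasCanonical f I := by
  set s := √(b ^ 2 - 4 * a * c) with hs
  have hs2 : s ^ 2 = b ^ 2 - 4 * a * c := Real.sq_sqrt hdisc
  have r1 : a * ((-b + s) / (2 * a)) ^ 2 + b * ((-b + s) / (2 * a)) + c = 0 := by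
    field_simp
    linear_combination hs2
  have r2 : a * ((-b - s) / (2 * a)) ^ 2 + b * ((-b - s) / (2 * a)) + c = 0 := by
    field_simp
    linear_combination hs2
  by_cases h1 : (-b + s) / (2 * a) ∈ I
  swap
  · exact hasCanonical_of_root hf ha r1 h1 h
  by_cases h2 : (-b - s) / (2 * a) ∈ I
  swap
  · exact hasCanonical_of_root hf ha r2 h2 h
  exfalso
  have hc := (classifying_iff hf).1 h
  have e1 : s = 2 * d := by
    have := hc _ h1
    rw [r1, zero_mul, add_zero] at this
    have := mul_right_cancel₀ (hf.ne_zero _ h1) this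
    field_simp at this
    linear_combination this
  have e2 : -s = 2 * d := by
    have := hc _ h2
    rw [r2, zero_mul, add_zero] at this
    have := mul_right_cancel₀ (hf.ne_zero _ h2) this
    field_simp at this
    linear_combination this
  have hd0 : d = 0 := by linarith
  have hs0 : s = 0 := by linarith
  rw [hs0] at r1 h1 hs2
  obtain ⟨C, hC⟩ := hf.isOpen.exists_is_const_of_deriv_eq_zero hf.ordConnected.isPreconnected
    (fun t ht => (h t ht).differentiableAt.differentiableWithinAt) fun t ht => by
      rw [(h t ht).deriv, hd0]; simp
  have hC0 := hC _ h1
  simp only [r1, zero_mul] at hC0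
  have hz : ∀ t ∈ I, a * t ^ 2 + b * t + c = 0 := fun t ht => by
    have := hC t ht
    rw [← hC0] at this
    exact (mul_eq_zero.1 this).resolve_right (hf.ne_zero t ht)
  exact ha (cubic_eq_zero hf.isOpen hf.nonempty (a := 0) (b := a) (c := b) (d := c)
    (fun t ht => by linear_combination hz t ht)).2.1

theorem hasCanonical_of_classifying (hf : InClass f I) {a b c d : ℝ}
    (hne : ¬ (a = 0 ∧ b = 0 ∧ c = 0 ∧ d = 0)) (h : Classifying f I a b c d) :
    HasCanonical f I := by
  by_cases ha : a = 0
  · subst ha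
    by_cases hbc : b = 0 ∧ c = 0
    · obtain ⟨rfl, rfl⟩ := hbc
      exfalso
      obtain ⟨t, ht⟩ := hf.nonempty
      have := (classifying_iff hf).1 h t ht
      simp [hf.ne_zero t ht] at this
      exact hne ⟨rfl, rfl, rfl, this⟩
    · exact hasCanonical_of_degenerate hf (by tauto) h
  · rcases lt_or_ge (b ^ 2 - 4 * a * c) 0 with hd | hd
    · exact hasCanonical_of_elliptic hf hd h
    · exact hasCanonical_of_split hf ha hd h

/-! ### Inequivalence of the canonical coefficients -/

/-- The discriminant of `τ` and the number `c` are invariants of the equivalence group. -/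
theorem MobiusCarries.exists_classifying (h : MobiusCarries α β γ δ k f I f' I') (hI : IsOpen I)
    {a b c d : ℝ} (hc : Classifying f I a b c d) : ∃ a' b' c', Classifying f' I' a' b' c' d ∧
      b' ^ 2 - 4 * a' * c' = b ^ 2 - 4 * a * c ∧
      a' * (α * δ - β * γ) = a * δ ^ 2 - b * δ * γ + c * γ ^ 2 := by
  have h1 := h.det_ne
  refine ⟨_, _, _, h.classifying hI hc, ?_, div_mul_cancel₀ _ h1⟩
  have key : (-2 * a * β * δ + b * (α * δ + β * γ) - 2 * c * α * γ) ^ 2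
      - 4 * (a * δ ^ 2 - b * δ * γ + c * γ ^ 2) * (a * β ^ 2 - b * α * β + c * α ^ 2)
      = (b ^ 2 - 4 * a * c) * (α * δ - β * γ) ^ 2 := by ring
  generalize α * δ - β * γ = e at *
  field_simp
  linear_combination key

theorem InClass.interval (hf : InClass f I) : IsOpen I ∧ I.OrdConnected ∧ I.Nonempty :=
  ⟨hf.isOpen, hf.ordConnected, hf.nonempty⟩

/-- A generator (τ, c) of one side goes to a solution on the other side with the same discriminant
and the same c. These are (-4, σ/2) for arctan, (4, ρ + 1) for a power and (0, 1) for the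
exponentials, where solutions are multiples m of the generator, so the discriminant scales by m².
For the constant coefficient every solution has discriminant 4 c². Comparison leaves only the sign
of m for arctan and powers, and the sign s for the exponentials. -/
theorem canonical_unique {c c' : ExtCase} (hf : InClass c.coeff I) (hf' : InClass c'.coeff I')
    (hc : c.Canonical I) (hc' : c'.Canonical I')
    (h : MobiusCarries α β γ δ k c.coeff I c'.coeff I') : c = c' := by
  obtain ⟨hI, hI2, hne⟩ := hf.interval
  obtain ⟨hJ, hJ2, hJne⟩ := hf'.interval
  have hdet := h.det_ne
  have key := fun {a b c d} => h.exists_classifying hI (a := a) (b := b) (c := c) (d := d)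
  have cA := fun σ => (arctan_classifying σ hJ hJ2 hJne)
  have cC := const_classifying hJ hJ2 hJne
  have cE : ∀ {s : ℝ}, (s = 1 ∨ s = -1) → _ := fun {s} hs =>
    exp_classifying (s := s) (by rcases hs with rfl | rfl <;> norm_num) hJ hJ2 hJne
  have cP : ∀ {ρ : ℝ}, ρ ≤ -1 ∧ ρ ≠ -2 ∧ (0 : ℝ) ∉ I' → _ := fun {ρ} hρ =>
    power_classifying (ρ := ρ) (by linarith [hρ.1]) hρ.2.1 hJ hJ2 hJne hρ.2.2
  obtain ⟨t, ht⟩ := hne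
  cases c with
  | arctan σ =>
    have el := (arctan_classifying σ hI hI2 ⟨t, ht⟩ _ _ _ _).2 ⟨1, rfl, rfl, rfl, rfl⟩
    obtain ⟨p, q, r, h1, h2, h3⟩ := key el
    cases c' with
    | arctan σ' =>
      obtain ⟨m, rfl, rfl, rfl, e4⟩ := (cA σ' _ _ _ _).1 h1
      -- Both coefficients are positive, so Δ > 0. With a' Δ = δ² + γ² this excludes m = -1, which
      -- would change the sign of σ.
      have hpos : 0 < α * δ - β * γ := by
        have e := h.coeff_eq t ht
        have p1 : 0 < (ExtCase.arctan σ).coeff t := by simp only [ExtCase.coeff]; positivity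
        have p2 : 0 < (ExtCase.arctan σ').coeff ((α * t + β) / (γ * t + δ)) := by
          simp only [ExtCase.coeff]; positivity
        have hD := h.ne t ht
        have hk := h.pos
        rw [e] at p2
        have p3 : 0 < k / (α * δ - β * γ) :=
          pos_of_mul_pos_left (pos_of_mul_pos_left p2 p1.le) (sq_nonneg _)
        exact (div_pos_iff_of_pos_left hk).1 p3
      have hm : 0 ≤ m := by
        refine nonneg_of_mul_nonneg_left (b := α * δ - β * γ) ?_ hpos
        nlinarith [sq_nonneg δ, sq_nonneg γ]
      have hm1 : m = 1 := by nlinarith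
      rw [hm1] at e4
      congr 1
      linarith
    | power ρ =>
      obtain ⟨m, rfl, rfl, rfl, -⟩ := (cP hc' _ _ _ _).1 h1
      nlinarith [sq_nonneg m]
    | exp s =>
      obtain ⟨m, rfl, rfl, rfl, -⟩ := (cE hc' _ _ _ _).1 h1
      nlinarith
    | const =>
      obtain ⟨rfl, rfl⟩ := (cC _ _ _ _).1 h1
      nlinarith [sq_nonneg σ]
  | power ρ =>
    have el := (power_classifying (ρ := ρ) (by linarith [hc.1]) hc.2.1 hI hI2 ⟨t, ht⟩ hc.2.2
      _ _ _ _).2 ⟨1, rfl, rfl, rfl, rfl⟩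
    obtain ⟨p, q, r, h1, h2, h3⟩ := key el
    have hρ := hc.1
    cases c' with
    | arctan σ' =>
      obtain ⟨m, rfl, rfl, rfl, -⟩ := (cA σ' _ _ _ _).1 h1
      nlinarith [sq_nonneg m]
    | power ρ' =>
      obtain ⟨m, rfl, rfl, rfl, e⟩ := (cP hc' _ _ _ _).1 h1
      have hρ' := hc'.1
      -- If m = -1, then ρ + 1 = -(ρ' + 1) with both sides constrained by ρ, ρ' ≤ -1, so both
      -- exponents are -1.
      have hm : (m - 1) * (m + 1) = 0 := by linear_combination h2 / 4
      congr 1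
      rcases mul_eq_zero.1 hm with hm | hm
      · rw [show m = 1 by linarith] at e
        linarith
      · rw [show m = -1 by linarith] at e
        linarith
    | exp s =>
      obtain ⟨m, rfl, rfl, rfl, -⟩ := (cE hc' _ _ _ _).1 h1
      nlinarith
    | const =>
      obtain ⟨rfl, rfl⟩ := (cC _ _ _ _).1 h1
      have : ρ * (ρ + 2) = 0 := by linear_combination h2 / 4
      rcases mul_eq_zero.1 this with h0 | h0
      · linarith
      · exact absurd (show ρ = -2 by linarith) hc.2.1
  | exp s =>
    have hs0 : s ≠ 0 := by rcases hc with rfl | rfl <;> norm_num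
    have el := (exp_classifying hs0 hI hI2 ⟨t, ht⟩ _ _ _ _).2 ⟨1, rfl, rfl, rfl, rfl⟩
    obtain ⟨p, q, r, h1, h2, h3⟩ := key el
    cases c' with
    | arctan σ' =>
      obtain ⟨m, rfl, rfl, rfl, e⟩ := (cA σ' _ _ _ _).1 h1
      have : m = 0 := by nlinarith
      simp [this] at e
    | power ρ' =>
      obtain ⟨m, rfl, rfl, rfl, e⟩ := (cP hc' _ _ _ _).1 h1
      have : m = 0 := by nlinarith
      simp [this] at e
    | exp s' =>
      obtain ⟨m, -, -, e1, e2⟩ := (cE hc' _ _ _ _).1 (h.classifying hI el)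
      -- Invariance of c forces m = 1, and the constant coefficient of τ gives α² = Δ > 0, so the
      -- transformation preserves the sign of f.
      have e3 : α ^ 2 = α * δ - β * γ := by
        have : m = 1 := by linarith
        rw [this] at e1
        field_simp at e1
        linear_combination e1 / 2
      have hpos : 0 < α * δ - β * γ := lt_of_le_of_ne (e3 ▸ sq_nonneg α) hdet.symm
      have e := h.coeff_eq t ht
      have hD := h.ne t ht
      have hk := h.pos
      have hp : 0 < k / (α * δ - β * γ) * (γ * t + δ) ^ 2 * Real.exp t := by positivity
      have hq := Real.exp_pos ((α * t + β) / (γ * t + δ))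
      simp only [ExtCase.coeff] at e
      congr 1
      rcases hc with rfl | rfl <;> rcases hc' with rfl | rfl
      · rfl
      · nlinarith
      · nlinarith
      · rfl
    | const =>
      obtain ⟨rfl, rfl⟩ := (cC _ _ _ _).1 h1
      nlinarith
  | const =>
    have el := (const_classifying hI hI2 ⟨t, ht⟩ 0 2 0 1).2 ⟨rfl, by norm_num⟩
    obtain ⟨p, q, r, h1, h2, h3⟩ := key el
    cases c' with
    | arctan σ' =>
      obtain ⟨m, rfl, rfl, rfl, e⟩ := (cA σ' _ _ _ _).1 h1
      nlinarith [sq_nonneg m]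
    | power ρ' =>
      obtain ⟨m, rfl, rfl, rfl, e⟩ := (cP hc' _ _ _ _).1 h1
      have : ρ' * (ρ' + 2) = 0 := by
        have hm : m ^ 2 = 1 := by linear_combination h2 / 4
        linear_combination -(ρ' + 1) ^ 2 * hm - (1 + m * (ρ' + 1)) * e
      rcases mul_eq_zero.1 this with h0 | h0
      · linarith [hc'.1]
      · exact absurd (show ρ' = -2 by linarith) hc'.2.1
    | exp s' =>
      obtain ⟨m, rfl, rfl, rfl, e⟩ := (cE hc' _ _ _ _).1 h1
      nlinarith
    | const => rfl

/-- Nontriviality is expressed through the invariants, discriminant and c, so that it survives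
transfer to any equivalent coefficient. -/
theorem exists_classifying_of_canonical {c : ExtCase} (hf : InClass c.coeff I) (hc : c.Canonical I) :
    ∃ p q r s, Classifying c.coeff I p q r s ∧ (q ^ 2 - 4 * p * r ≠ 0 ∨ s ≠ 0) := by
  obtain ⟨hI, hI2, hne⟩ := hf.interval
  cases c with
  | arctan σ =>
    exact ⟨_, _, _, _, (arctan_classifying σ hI hI2 hne _ _ _ _).2 ⟨1, rfl, rfl, rfl, rfl⟩,
      by norm_num⟩
  | power ρ =>
    exact ⟨_, _, _, _, (power_classifying (by linarith [hc.1]) hc.2.1 hI hI2 hne hc.2.2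
      _ _ _ _).2 ⟨1, rfl, rfl, rfl, rfl⟩, by norm_num⟩
  | exp s =>
    exact ⟨_, _, _, _, (exp_classifying (by rcases hc with rfl | rfl <;> norm_num) hI hI2 hne
      _ _ _ _).2 ⟨1, rfl, rfl, rfl, rfl⟩, by norm_num⟩
  | const =>
    exact ⟨0, 2, 0, 1, (const_classifying hI hI2 hne _ _ _ _).2 ⟨rfl, by norm_num⟩, by norm_num⟩

theorem classification (hf : InClass f I) :
    (IsBasisOfMaxAlgebra f I kernelBasis ∧ ¬ ∃ (c : ExtCase) (I' : Set ℝ),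
      c.Canonical I' ∧ Equivalent f I c.coeff I') ∨
    (¬ IsBasisOfMaxAlgebra f I kernelBasis ∧
      ∃! c : ExtCase, ∃ I' : Set ℝ, c.Canonical I' ∧ Equivalent f I c.coeff I') := by
  by_cases hb : IsBasisOfMaxAlgebra f I kernelBasis
  · refine Or.inl ⟨hb, ?_⟩
    rintro ⟨c, I', hc, he⟩
    obtain ⟨α, β, γ, δ, k, hm⟩ := equivalent_iff.1 he
    have hf' := hm.inClass hf
    obtain ⟨p, q, r, s, hcl, hne⟩ := exists_classifying_of_canonical hf' hc
    obtain ⟨p', q', r', hcl', hd, -⟩ := hm.symm.exists_classifying hf'.isOpen hcl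
    obtain ⟨rfl, rfl, rfl, rfl⟩ := classifying_eq_zero_of_kernel hf hb hcl'
    rcases hne with h | h
    · exact h (by rw [← hd]; norm_num)
    · exact h rfl
  · refine Or.inr ⟨hb, ?_⟩
    have : ∃ a b c d, Classifying f I a b c d ∧ ¬ (a = 0 ∧ b = 0 ∧ c = 0 ∧ d = 0) := by
      by_contra! h
      exact hb (kernel_isBasis hf fun a b c d hc => h a b c d hc)
    obtain ⟨a, b, c, d, hcl, hne⟩ := this
    obtain ⟨c, I', hc, he⟩ := hasCanonical_of_classifying hf hne hcl
    refine ⟨c, ⟨I', hc, he⟩, ?_⟩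
    rintro c' ⟨I'', hc', he'⟩
    obtain ⟨_, _, _, _, _, hm⟩ := equivalent_iff.1 he
    obtain ⟨_, _, _, _, _, hm'⟩ := equivalent_iff.1 he'
    exact canonical_unique (hm'.inClass hf) (hm.inClass hf) hc' hc (hm'.symm.trans hm)

end Kolmogorov

namespace Kolmogorov

variable {I I' : Set ℝ} {f f' : ℝ → ℝ} {s : Fin 3 → ℝ}

/-! ### The equivalence group maps solutions to solutions -/

/-- The action of an equivalence transformation on the independent variables. -/
noncomputable def EquivTransf.baseMap (g : EquivTransf) (s : Fin 3 → ℝ) : Fin 3 → ℝ :=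
  (g.pointMap (s, 0)).1

/-- The inverse of `EquivTransf.baseMap`. -/
noncomputable def EquivTransf.baseInv (g : EquivTransf) (s : Fin 3 → ℝ) : Fin 3 → ℝ :=
  let t := (g.δ * s 0 + -g.β) / (-g.γ * s 0 + g.α)
  ![t, ((g.γ * t + g.δ) * s 1 - g.μ * t - g.ν) / g.κ, (s 2 - g.ε) / g.lam]

theorem isOpen_slab (hI : IsOpen I) : IsOpen {s : Fin 3 → ℝ | s 0 ∈ I} :=
  hI.preimage (continuous_apply 0)

namespace EquivTransf.Carries

variable {g : EquivTransf} (h : g.Carries f I f' I')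
include h

theorem baseMap_mem (hs : s 0 ∈ I) : g.baseMap s 0 ∈ I' := h.mobius.mem hs

theorem baseInv_mem (hs : s 0 ∈ I') : g.baseInv s 0 ∈ I := h.mobius.symm.mem hs

theorem baseMap_baseInv (hs : s 0 ∈ I') : g.baseMap (g.baseInv s) = s := by
  obtain ⟨t, ht, e⟩ := h.mobius.exists_eq hs
  have h1 := h.mobius.left_inv ht
  rw [e] at h1
  have hD := h.1 t ht
  have hκ := g.κ_ne
  have hl := g.lam_ne
  have hinv : g.baseInv s = ![t, ((g.γ * t + g.δ) * s 1 - g.μ * t - g.ν) / g.κ,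
      (s 2 - g.ε) / g.lam] := by simp only [baseInv, h1]
  rw [hinv]
  funext i
  fin_cases i
  · simpa [baseMap, pointMap] using e
  · simp [baseMap, pointMap]
    field_simp
    ring
  · simp [baseMap, pointMap]
    field_simp
    ring

theorem contDiffOn_baseMap : ContDiffOn ℝ 2 g.baseMap {s | s 0 ∈ I} := by
  have h1 := h.1
  refine contDiffOn_pi.2 fun i => ?_
  fin_cases i
  · exact ContDiffOn.div (by fun_prop) (by fun_prop) fun s hs => h1 _ hs
  · exact ContDiffOn.div (by fun_prop) (by fun_prop) fun s hs => h1 _ hs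
  · simp only [baseMap, pointMap]
    simp
    fun_prop

theorem contDiffOn_baseInv : ContDiffOn ℝ 2 g.baseInv {s | s 0 ∈ I'} := by
  have ht : ContDiffOn ℝ 2 (fun s : Fin 3 → ℝ => (g.δ * s 0 + -g.β) / (-g.γ * s 0 + g.α))
      {s | s 0 ∈ I'} :=
    ContDiffOn.div (by fun_prop) (by fun_prop) fun s hs => h.mobius.symm.ne _ hs
  refine contDiffOn_pi.2 fun i => ?_
  fin_cases i
  · exact ht
  · simp only [baseInv]
    simp only [neg_mul] at ht
    simp
    fun_prop
  · simp only [baseInv]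
    simp
    fun_prop

theorem hasDerivAt_baseMap (hs : s 0 ∈ I) :
    HasDerivAt (fun r : ℝ => g.baseMap (s + r • Pi.single 0 1))
      ![g.det / (g.γ * s 0 + g.δ) ^ 2,
        (g.μ * g.δ - g.γ * g.ν - g.γ * g.κ * s 1) / (g.γ * s 0 + g.δ) ^ 2, 0] 0 ∧
    HasDerivAt (fun r : ℝ => g.baseMap (s + r • Pi.single 1 1))
      ![0, g.κ / (g.γ * s 0 + g.δ), 0] 0 ∧
    HasDerivAt (fun r : ℝ => g.baseMap (s + r • Pi.single 2 1)) ![0, 0, g.lam] 0 := by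
  have hD := h.1 _ hs
  have lin : ∀ a b : ℝ, HasDerivAt (fun r : ℝ => b + a * r) a 0 := fun a b => by
    simpa using ((hasDerivAt_id (0 : ℝ)).const_mul a).const_add b
  have hden : HasDerivAt (fun r : ℝ => g.γ * (s 0 + r) + g.δ) g.γ 0 := by
    refine (lin g.γ (g.γ * s 0 + g.δ)).congr_of_eventuallyEq (.of_forall fun r => ?_)
    simp; ring
  refine ⟨hasDerivAt_pi.2 fun i => ?_, hasDerivAt_pi.2 fun i => ?_, hasDerivAt_pi.2 fun i => ?_⟩
  · fin_cases i
    · have := (lin g.α (g.α * s 0 + g.β)).div hden (by simpa using hD)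
      refine (this.congr_of_eventuallyEq (.of_forall fun r => ?_)).congr_deriv ?_
      · simp [baseMap, pointMap]; ring
      · simp [EquivTransf.det]; ring
    · have := (lin g.μ (g.κ * s 1 + g.μ * s 0 + g.ν)).div hden (by simpa using hD)
      refine (this.congr_of_eventuallyEq (.of_forall fun r => ?_)).congr_deriv ?_
      · simp [baseMap, pointMap]; ring
      · simp; ring
    · refine ((hasDerivAt_const (0 : ℝ) (g.lam * s 2 + g.ε)).congr_of_eventuallyEq
        (.of_forall fun r => ?_))
      simp [baseMap, pointMap]
  · fin_cases i
    · refine ((hasDerivAt_const (0 : ℝ) ((g.α * s 0 + g.β) / (g.γ * s 0 + g.δ))).congr_of_eventuallyEq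
        (.of_forall fun r => ?_))
      simp [baseMap, pointMap]
    · have := (lin g.κ (g.κ * s 1 + g.μ * s 0 + g.ν)).div_const (g.γ * s 0 + g.δ)
      refine (this.congr_of_eventuallyEq (.of_forall fun r => ?_))
      simp [baseMap, pointMap]; ring
    · refine ((hasDerivAt_const (0 : ℝ) (g.lam * s 2 + g.ε)).congr_of_eventuallyEq
        (.of_forall fun r => ?_))
      simp [baseMap, pointMap]
  · fin_cases i
    · refine ((hasDerivAt_const (0 : ℝ) ((g.α * s 0 + g.β) / (g.γ * s 0 + g.δ))).congr_of_eventuallyEq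
        (.of_forall fun r => ?_))
      simp [baseMap, pointMap]
    · refine ((hasDerivAt_const (0 : ℝ) ((g.κ * s 1 + g.μ * s 0 + g.ν) /
        (g.γ * s 0 + g.δ))).congr_of_eventuallyEq (.of_forall fun r => ?_))
      simp [baseMap, pointMap]
    · refine ((lin g.lam (g.lam * s 2 + g.ε)).congr_of_eventuallyEq (.of_forall fun r => ?_))
      simp [baseMap, pointMap]; ring

end EquivTransf.Carries

theorem hasDerivAt_coordLine {w : (Fin 3 → ℝ) → ℝ} (hw : DifferentiableAt ℝ w s) (i : Fin 3) :
    HasDerivAt (fun r : ℝ => w (s + r • Pi.single i 1)) (fderiv ℝ w s (Pi.single i 1)) 0 := by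
  have h1 : HasDerivAt (fun r : ℝ => s + r • (Pi.single i 1 : Fin 3 → ℝ)) (Pi.single i 1) 0 := by
    simpa using ((hasDerivAt_id (0 : ℝ)).smul_const (Pi.single i 1 : Fin 3 → ℝ)).const_add s
  have h2 : HasFDerivAt w (fderiv ℝ w s) (s + (0 : ℝ) • (Pi.single i 1 : Fin 3 → ℝ)) := by
    simpa using hw.hasFDerivAt
  exact HasFDerivAt.comp_hasDerivAt (f := fun r : ℝ => s + r • (Pi.single i 1 : Fin 3 → ℝ)) (0 : ℝ)
    h2 h1

theorem clm_vec (L : (Fin 3 → ℝ) →L[ℝ] ℝ) (a b c : ℝ) : L ![a, b, c]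
    = a * L (Pi.single 0 1) + b * L (Pi.single 1 1) + c * L (Pi.single 2 1) := by
  have : ![a, b, c] = a • Pi.single 0 1 + b • Pi.single 1 1 + c • (Pi.single 2 1 : Fin 3 → ℝ) := by
    funext i
    fin_cases i <;> simp
  rw [this]
  simp

namespace EquivTransf.Carries

variable {g : EquivTransf} (h : g.Carries f I f' I') (hI : IsOpen I) {w v : (Fin 3 → ℝ) → ℝ}
include h hI

/-- Chain rule for the substitution `EquivTransf.baseMap`. -/
theorem chain_rule (hs : s 0 ∈ I) (hv : DifferentiableAt ℝ v (g.baseMap s))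
    (hw : DifferentiableAt ℝ w s) {p q : ℝ → ℝ → ℝ}
    (hwv : ∀ s : Fin 3 → ℝ, s 0 ∈ I → v (g.baseMap s) = p (s 0) (s 1) * w s + q (s 0) (s 1))
    {p₀ p₁ q₀ q₁ : ℝ} (hp0 : HasDerivAt (fun r => p (s 0 + r) (s 1)) p₀ 0)
    (hp1 : HasDerivAt (fun r => p (s 0) (s 1 + r)) p₁ 0)
    (hq0 : HasDerivAt (fun r => q (s 0 + r) (s 1)) q₀ 0)
    (hq1 : HasDerivAt (fun r => q (s 0) (s 1 + r)) q₁ 0) :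
    g.det / (g.γ * s 0 + g.δ) ^ 2 * fderiv ℝ v (g.baseMap s) (Pi.single 0 1)
      + (g.μ * g.δ - g.γ * g.ν - g.γ * g.κ * s 1) / (g.γ * s 0 + g.δ) ^ 2
        * fderiv ℝ v (g.baseMap s) (Pi.single 1 1)
      = p₀ * w s + p (s 0) (s 1) * fderiv ℝ w s (Pi.single 0 1) + q₀ ∧
    g.κ / (g.γ * s 0 + g.δ) * fderiv ℝ v (g.baseMap s) (Pi.single 1 1)
      = p₁ * w s + p (s 0) (s 1) * fderiv ℝ w s (Pi.single 1 1) + q₁ ∧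
    g.lam * fderiv ℝ v (g.baseMap s) (Pi.single 2 1)
      = p (s 0) (s 1) * fderiv ℝ w s (Pi.single 2 1) := by
  obtain ⟨b0, b1, b2⟩ := h.hasDerivAt_baseMap hs
  have comp : ∀ {i : Fin 3} {d : Fin 3 → ℝ},
      HasDerivAt (fun r : ℝ => g.baseMap (s + r • Pi.single i 1)) d 0 →
      HasDerivAt (fun r : ℝ => v (g.baseMap (s + r • Pi.single i 1)))
        (fderiv ℝ v (g.baseMap s) d) 0 := fun {i d} hb => by
    refine HasFDerivAt.comp_hasDerivAt (f := fun r : ℝ => g.baseMap (s + r • Pi.single i 1))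
      (0 : ℝ) ?_ hb
    simpa using hv.hasFDerivAt
  have hw' := hasDerivAt_coordLine hw
  have ev : ∀ i : Fin 3, ∀ᶠ r : ℝ in nhds 0, (s + r • (Pi.single i 1 : Fin 3 → ℝ)) 0 ∈ I := by
    intro i
    have hc : ContinuousAt (fun r : ℝ => (s + r • (Pi.single i 1 : Fin 3 → ℝ)) 0) 0 := by
      fun_prop
    exact hc (by simpa using hI.mem_nhds hs)
  refine ⟨?_, ?_, ?_⟩
  · have e := (comp b0).unique (((hp0.mul (hw' 0)).add hq0).congr_of_eventuallyEq (by
      filter_upwards [ev 0] with r hr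
      rw [hwv _ hr]; simp))
    rw [clm_vec] at e
    simp at e
    linear_combination e
  · have e := (comp b1).unique (((hp1.mul (hw' 1)).add hq1).congr_of_eventuallyEq (by
      filter_upwards [ev 1] with r hr
      rw [hwv _ hr]; simp))
    rw [clm_vec] at e
    simp at e
    linear_combination e
  · have e := (comp b2).unique ((((hw' 2).const_mul (p (s 0) (s 1))).add_const
      (q (s 0) (s 1))).congr_of_eventuallyEq (by
      filter_upwards [ev 2] with r hr
      rw [hwv _ hr]; simp))
    rw [clm_vec] at e
    simp at e
    linear_combination e

/-- The chain rule is used once for the solution and once for its y-derivative, giving the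
transformed u_t, u_x and u_yy. In the combination the terms from x̃ depending on t and from the
affine part of ũ cancel, leaving a common factor. -/
theorem equation_jetOf (hv : ContDiffOn ℝ 2 v {s | s 0 ∈ I'}) (hw : ContDiffOn ℝ 2 w {s | s 0 ∈ I})
    (hwv : ∀ s : Fin 3 → ℝ, s 0 ∈ I → v (g.baseMap s) = (g.pointMap (s, w s)).2)
    (hs : s 0 ∈ I) : equation f' (jetOf v (g.baseMap s)) =
      g.κ * (g.γ * s 0 + g.δ) ^ 3 / g.det ^ 2 * equation f (jetOf w s) := by
  have hI' := h.mobius.isOpen hI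
  have cv : ∀ s : Fin 3 → ℝ, s 0 ∈ I → ContDiffAt ℝ 2 v (g.baseMap s) := fun s hs =>
    hv.contDiffAt ((isOpen_slab hI').mem_nhds (h.baseMap_mem hs))
  have cw : ∀ s : Fin 3 → ℝ, s 0 ∈ I → ContDiffAt ℝ 2 w s := fun s hs =>
    hw.contDiffAt ((isOpen_slab hI).mem_nhds hs)
  have dv := fun s hs => (cv s hs).differentiableAt (by simp)
  have dw := fun s hs => (cw s hs).differentiableAt (by simp)
  have d2 : ∀ {w : (Fin 3 → ℝ) → ℝ} {s : Fin 3 → ℝ}, ContDiffAt ℝ 2 w s →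
      DifferentiableAt ℝ (fun s => fderiv ℝ w s (Pi.single 2 1)) s := fun hw =>
    ((hw.fderiv_right (m := 1) (by norm_num)).differentiableAt (by simp)).clm_apply
      (differentiableAt_const _)
  have lin : ∀ a b : ℝ, HasDerivAt (fun r : ℝ => a * r + b) a 0 := fun a b => by
    simpa using ((hasDerivAt_id (0 : ℝ)).const_mul a).add_const b
  have first := fun (s : Fin 3 → ℝ) (hs : s 0 ∈ I) => h.chain_rule hI hs (dv s hs) (dw s hs)
    (p := fun t _ => g.κ * (g.γ * t + g.δ) / g.det)
    (q := fun _ x => (- g.κ * g.γ * x + g.δ * g.μ - g.γ * g.ν) / g.det)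
    (p₀ := g.κ * g.γ / g.det) (p₁ := 0) (q₀ := 0) (q₁ := -g.κ * g.γ / g.det)
    (fun s hs => by rw [hwv s hs]; simp [pointMap]; ring)
    ((lin (g.κ * g.γ / g.det) (g.κ * (g.γ * s 0 + g.δ) / g.det)).congr_of_eventuallyEq
      (.of_forall fun r => by ring))
    (hasDerivAt_const _ _) (hasDerivAt_const _ _)
    ((lin (-g.κ * g.γ / g.det)
      ((- g.κ * g.γ * s 1 + g.δ * g.μ - g.γ * g.ν) / g.det)).congr_of_eventuallyEq
      (.of_forall fun r => by ring))
  have hl := g.lam_ne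
  -- The y-derivatives are related by multiplication with p / λ, a relation of the same shape with q
  -- = 0, so the chain rule applies again.
  have second := (h.chain_rule hI hs (v := fun s => fderiv ℝ v s (Pi.single 2 1))
    (w := fun s => fderiv ℝ w s (Pi.single 2 1)) (d2 (cv s hs)) (d2 (cw s hs))
    (p := fun t _ => g.κ * (g.γ * t + g.δ) / g.det / g.lam) (q := fun _ _ => 0)
    (p₀ := g.κ * g.γ / g.det / g.lam) (p₁ := 0) (q₀ := 0) (q₁ := 0)
    (fun s hs => by
      have := (first s hs).2.2
      field_simp at this ⊢
      linear_combination this)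
    ((lin (g.κ * g.γ / g.det / g.lam)
      (g.κ * (g.γ * s 0 + g.δ) / g.det / g.lam)).congr_of_eventuallyEq
      (.of_forall fun r => by ring))
    (hasDerivAt_const _ _) (hasDerivAt_const _ _) (hasDerivAt_const _ _)).2.2
  obtain ⟨e0, e1, -⟩ := first s hs
  have hc : f' (g.baseMap s 0) = g.lam ^ 2 / g.det * (g.γ * s 0 + g.δ) ^ 2 * f (s 0) :=
    h.2.2 (s, 0) hs
  have hD := h.1 _ hs
  have hΔ : g.det ≠ 0 := g.det_ne
  have hκ := g.κ_ne
  have hvs : v (g.baseMap s) = 1 / g.det * (g.κ * (g.γ * s 0 + g.δ) * w s - g.κ * g.γ * s 1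
    + g.δ * g.μ - g.γ * g.ν) := hwv s hs
  simp only [equation, jetOf]
  rw [hc, hvs]
  generalize fderiv ℝ v (g.baseMap s) (Pi.single 0 1) = v0 at *
  generalize fderiv ℝ v (g.baseMap s) (Pi.single 1 1) = v1 at *
  generalize fderiv ℝ (fun s => fderiv ℝ v s (Pi.single 2 1)) (g.baseMap s) (Pi.single 2 1) = v22
    at *
  generalize fderiv ℝ w s (Pi.single 0 1) = w0 at *
  generalize fderiv ℝ w s (Pi.single 1 1) = w1 at *
  generalize fderiv ℝ (fun s => fderiv ℝ w s (Pi.single 2 1)) s (Pi.single 2 1) = w22 at *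
  generalize g.γ * s 0 + g.δ = D at *
  generalize g.det = Δ at *
  have hv1 : v1 = D ^ 2 / Δ * w1 - D * g.γ / Δ := by
    field_simp at e1 ⊢
    refine mul_left_cancel₀ hκ ?_
    linear_combination e1
  have hv0 : v0 = D ^ 2 / Δ * (g.κ * g.γ / Δ * w s + g.κ * D / Δ * w0)
      - (g.μ * g.δ - g.γ * g.ν - g.γ * g.κ * s 1) / Δ * v1 := by
    field_simp at e0 ⊢
    linear_combination e0
  have hv22 : v22 = g.κ * D / (Δ * g.lam ^ 2) * w22 := by
    field_simp at second ⊢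
    linear_combination second
  rw [hv0, hv1, hv22]
  field_simp
  ring

/-- C² regularity passes both ways because the base map has an explicit smooth inverse and the
relation between v and w can be solved for w. The equation then transfers because the factor in
`equation_jetOf` does not vanish. -/
theorem isSolution_iff
    (hwv : ∀ s : Fin 3 → ℝ, s 0 ∈ I → v (g.baseMap s) = (g.pointMap (s, w s)).2) :
    IsSolution f I w ↔ IsSolution f' I' v := by
  have hΔ : g.det ≠ 0 := g.det_ne
  have hκ := g.κ_ne
  have hval : ∀ s : Fin 3 → ℝ, s 0 ∈ I → w s = (g.det * v (g.baseMap s) + g.κ * g.γ * s 1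
      - g.δ * g.μ + g.γ * g.ν) / (g.κ * (g.γ * s 0 + g.δ)) := fun s hs => by
    have hD := h.1 _ hs
    rw [hwv s hs]
    simp [pointMap]
    field_simp
    ring
  have regular : ContDiffOn ℝ 2 w {s | s 0 ∈ I} ↔ ContDiffOn ℝ 2 v {s | s 0 ∈ I'} := by
    constructor
    · intro hw
      have h1 : ContDiffOn ℝ 2 (fun s => (g.pointMap (s, w s)).2) {s | s 0 ∈ I} := by
        simp only [pointMap]
        fun_prop
      refine (h1.comp h.contDiffOn_baseInv fun s hs => h.baseInv_mem hs).congr fun s hs => ?_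
      rw [Function.comp, ← hwv _ (h.baseInv_mem hs), h.baseMap_baseInv hs]
    · intro hv
      have h1 := hv.comp h.contDiffOn_baseMap fun s hs => h.baseMap_mem hs
      refine ContDiffOn.congr ?_ hval
      refine ContDiffOn.div ?_ (by fun_prop) fun s hs => mul_ne_zero hκ (h.1 _ hs)
      exact (((contDiffOn_const.mul h1).add (by fun_prop)).sub (by fun_prop)).add (by fun_prop)
  constructor
  · rintro ⟨hw, he⟩
    have hv := regular.1 hw
    refine ⟨hv, fun s hs => ?_⟩
    have := h.equation_jetOf hI hv hw hwv (h.baseInv_mem hs)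
    rwa [h.baseMap_baseInv hs, he _ (h.baseInv_mem hs), mul_zero] at this
  · rintro ⟨hv, he⟩
    have hw := regular.2 hv
    refine ⟨hw, fun s hs => ?_⟩
    have := h.equation_jetOf hI hv hw hwv hs
    rw [he _ (h.baseMap_mem hs)] at this
    refine (mul_eq_zero.1 this.symm).resolve_left ?_
    exact div_ne_zero (mul_ne_zero hκ (pow_ne_zero _ (h.1 _ hs))) (pow_ne_zero _ hΔ)

end EquivTransf.Carries

end Kolmogorov

/-! ### Assembly of the theorem -/

namespace Kolmogorov

variable {I I' : Set ℝ} {f f' : ℝ → ℝ}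

theorem carries_inClass_and_solutions (g : EquivTransf) (hf : InClass f I)
    (h : g.Carries f I f' I') : InClass f' I' ∧ ∀ w v : (Fin 3 → ℝ) → ℝ,
      g.pointMap '' {z ∈ dom I | z.2 = w z.1} = {z ∈ dom I' | z.2 = v z.1} →
      (IsSolution f I w ↔ IsSolution f' I' v) := by
  refine ⟨h.mobius.inClass hf, fun w v hwv => h.isSolution_iff hf.isOpen fun s hs => ?_⟩
  have hm : g.pointMap (s, w s) ∈ {z ∈ dom I' | z.2 = v z.1} := hwv ▸ ⟨(s, w s), ⟨hs, rfl⟩, rfl⟩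
  exact hm.2.symm

theorem arctan_isBasis (σ : ℝ) (hI : IsOpen I) (hI' : I.OrdConnected) (hne : I.Nonempty) :
    IsBasisOfMaxAlgebra (ExtCase.arctan σ).coeff I
      ![dX, dY, scaling, galilean, extArctan σ] := by
  refine basis_five_of (arctan_inClass σ hI hI' hne) (fun z => ?_)
    (fun h => one_ne_zero (congrFun h 0)) (arctan_classifying σ hI hI' hne)
  refine Prod.ext (funext fun k => ?_) ?_
  · fin_cases k <;> simp [extArctan, field]
    exact Or.inl (by ring)
  · simp [extArctan, field]
    ring

theorem power_isBasis {ρ : ℝ} (hρ : ρ ≠ 0) (hρ' : ρ ≠ -2) (hI : IsOpen I) (hI' : I.OrdConnected)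
    (hne : I.Nonempty) (h0 : (0 : ℝ) ∉ I) :
    IsBasisOfMaxAlgebra (ExtCase.power ρ).coeff I ![dX, dY, scaling, galilean, extPower ρ] := by
  refine basis_five_of (power_inClass ρ hI hI' hne h0) (fun z => ?_)
    (fun h => two_ne_zero (congrFun h 1)) (power_classifying hρ hρ' hI hI' hne h0)
  refine Prod.ext (funext fun k => ?_) ?_
  · fin_cases k <;> simp [extPower, field]
  · simp [extPower, field]

theorem exp_isBasis {s : ℝ} (hs : s ≠ 0) (hI : IsOpen I) (hI' : I.OrdConnected)
    (hne : I.Nonempty) :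
    IsBasisOfMaxAlgebra (ExtCase.exp s).coeff I ![dX, dY, scaling, galilean, extExp] := by
  refine basis_five_of (exp_inClass hs hI hI' hne) (fun z => ?_)
    (fun h => two_ne_zero (congrFun h 2)) (exp_classifying hs hI hI' hne)
  refine Prod.ext (funext fun k => ?_) ?_
  · fin_cases k <;> simp [extExp, field]
  · simp [extExp, field]

end Kolmogorov

theorem mainTheorem2 :
    -- the transformations of the equivalence group map equations of the class to each other
    (∀ (g : Kolmogorov.EquivTransf) (f : ℝ → ℝ) (I : Set ℝ) (f' : ℝ → ℝ) (I' : Set ℝ),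
      Kolmogorov.InClass f I → g.Carries f I f' I' →
        Kolmogorov.InClass f' I' ∧
        ∀ w v : (Fin 3 → ℝ) → ℝ,
          g.pointMap '' {z ∈ Kolmogorov.dom I | z.2 = w z.1} =
            {z ∈ Kolmogorov.dom I' | z.2 = v z.1} →
          (Kolmogorov.IsSolution f I w ↔ Kolmogorov.IsSolution f' I' v)) ∧
    -- the Lie symmetries of each equation are closed under the Lie bracket
    (∀ (f : ℝ → ℝ) (I : Set ℝ), Kolmogorov.InClass f I →
      ∀ V W : Kolmogorov.VField, Kolmogorov.IsLieSymmetry f I V →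
        Kolmogorov.IsLieSymmetry f I W →
        Kolmogorov.IsLieSymmetry f I (VectorField.lieBracket ℝ V W)) ∧
    -- arbitrary `f`: the fields common to all equations of the class, and their independence;
    -- for some `f` there are no other symmetries
    (∀ I : Set ℝ, IsOpen I → I.OrdConnected → I.Nonempty →
      LinearIndependent ℝ
        (fun i => (Kolmogorov.dom I).domRestrict (Kolmogorov.kernelBasis i)) ∧
      (∀ V : Kolmogorov.VField,
        (∀ f : ℝ → ℝ, Kolmogorov.InClass f I → Kolmogorov.IsLieSymmetry f I V) ↔
          (Kolmogorov.dom I).domRestrict V ∈ Submodule.span ℝ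
            (Set.range fun i => (Kolmogorov.dom I).domRestrict (Kolmogorov.kernelBasis i))) ∧
      ∃ f : ℝ → ℝ, Kolmogorov.InClass f I ∧
        Kolmogorov.IsBasisOfMaxAlgebra f I Kolmogorov.kernelBasis) ∧
    -- `f = e^{σ arctan t} / (t² + 1)`
    (∀ (σ : ℝ) (I : Set ℝ), IsOpen I → I.OrdConnected → I.Nonempty →
      Kolmogorov.IsBasisOfMaxAlgebra (Kolmogorov.ExtCase.arctan σ).coeff I
        ![Kolmogorov.dX, Kolmogorov.dY, Kolmogorov.scaling, Kolmogorov.galilean,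
          Kolmogorov.extArctan σ]) ∧
    -- `f = |t|^ρ`
    (∀ (ρ : ℝ) (I : Set ℝ), ρ ≠ 0 → ρ ≠ -2 → IsOpen I → I.OrdConnected → I.Nonempty →
      (0 : ℝ) ∉ I →
      Kolmogorov.IsBasisOfMaxAlgebra (Kolmogorov.ExtCase.power ρ).coeff I
        ![Kolmogorov.dX, Kolmogorov.dY, Kolmogorov.scaling, Kolmogorov.galilean,
          Kolmogorov.extPower ρ]) ∧
    -- the exponents `ρ` and `-2 - ρ` are equivalent
    (∀ (ρ : ℝ) (I : Set ℝ), IsOpen I → I.OrdConnected → I.Nonempty → (0 : ℝ) ∉ I →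
      Kolmogorov.Equivalent (Kolmogorov.ExtCase.power ρ).coeff I
        (Kolmogorov.ExtCase.power (-2 - ρ)).coeff ((fun t : ℝ => -1 / t) '' I)) ∧
    -- `f = ± e^t`
    (∀ (s : ℝ) (I : Set ℝ), s = 1 ∨ s = -1 → IsOpen I → I.OrdConnected → I.Nonempty →
      Kolmogorov.IsBasisOfMaxAlgebra (Kolmogorov.ExtCase.exp s).coeff I
        ![Kolmogorov.dX, Kolmogorov.dY, Kolmogorov.scaling, Kolmogorov.galilean,
          Kolmogorov.extExp]) ∧
    -- `f = 1`
    (∀ I : Set ℝ, IsOpen I → I.OrdConnected → I.Nonempty →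
      Kolmogorov.IsBasisOfMaxAlgebra Kolmogorov.ExtCase.const.coeff I
        ![Kolmogorov.dX, Kolmogorov.dY, Kolmogorov.scaling, Kolmogorov.galilean,
          Kolmogorov.dT, Kolmogorov.extConst]) ∧
    -- the list is complete and its members are inequivalent
    (∀ (f : ℝ → ℝ) (I : Set ℝ), Kolmogorov.InClass f I →
      (Kolmogorov.IsBasisOfMaxAlgebra f I Kolmogorov.kernelBasis ∧
        ¬ ∃ (c : Kolmogorov.ExtCase) (I' : Set ℝ),
          c.Canonical I' ∧ Kolmogorov.Equivalent f I c.coeff I') ∨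
      (¬ Kolmogorov.IsBasisOfMaxAlgebra f I Kolmogorov.kernelBasis ∧
        ∃! c : Kolmogorov.ExtCase, ∃ I' : Set ℝ,
          c.Canonical I' ∧ Kolmogorov.Equivalent f I c.coeff I')) := by
  refine ⟨fun g f I f' I' hf h => Kolmogorov.carries_inClass_and_solutions g hf h,
    fun f I hf V W hV hW => Kolmogorov.isLieSymmetry_lieBracket hf hV hW,
    fun I h1 h2 h3 => ?_, fun σ I h1 h2 h3 => Kolmogorov.arctan_isBasis σ h1 h2 h3,
    fun ρ I hρ hρ' h1 h2 h3 h0 => Kolmogorov.power_isBasis hρ hρ' h1 h2 h3 h0,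
    fun ρ I _ _ _ h0 => Kolmogorov.equivalent_iff.2 ⟨_, _, _, _, _,
      Kolmogorov.power_mobiusCarries ρ h0⟩,
    fun s I hs h1 h2 h3 => Kolmogorov.exp_isBasis ?_ h1 h2 h3,
    fun I h1 h2 h3 => Kolmogorov.const_isBasis h1 h2 h3,
    fun f I hf => Kolmogorov.classification hf⟩
  · have hf := Kolmogorov.expSq_inClass h1 h2 h3
    have hb := Kolmogorov.kernel_isBasis hf (Kolmogorov.expSq_classifying h1 h2 h3)
    exact ⟨hb.1, Kolmogorov.kernel_common h1 h2 h3, _, hf, hb⟩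
  · rcases hs with rfl | rfl <;> norm_num
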